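/- Let $k\in\mathbb N$. A $k$-graph is a countable small category $\Lambda$ (identified with its set of morphisms, objects being identity morphisms; $\lambda\mu$ is defined when $s(\lambda)=r(\mu)$) with a functor $d:\Lambda\to\mathbb N^k$ such that whenever $d(\lambda)=p+q$ there are unique $\mu,\nu$ with $\lambda=\mu\nu$, $d(\mu)=p$, $d(\nu)=q$. A graph morphism is a degree-preserving functor. $\Lambda$ is finitely aligned if every $\mu\Lambda\cap\nu\Lambda$ is a finite union of sets $\lambda\Lambda$. Let $\Lambda$ be a finitely aligned $k$-graph. *Path prototypes.* For an increasing sequence $(m_n)$ in $\mathbb N^k$ let $\Omega_{\mathbb N^k,(m_n)}=\bigcup_n\{(p,q)\in\mathbb N^k\times\mathbb N^k: p\le q\le m_n\}$, and for $m\in(\mathbb N\cup\{\infty\})^k$ let $\Omega_{k,m}=\{(p,q)\in\mathbb N^k\times\mathbb N^k: p\le q\le m\}$; both are $k$-graphs with $r(p,q)=(p,p)$, $s(p,q)=(q,q)$, $(p,q)(q,r)=(p,r)$ and $d(p,q)=q-p$. *Path spaces and actions.* $\mathrm{PS_m}(\Lambda)$ is the set of graph morphisms $x:D_x\to\Lambda$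 with $D_x=\Omega_{\mathbb N^k,(m_n)}$ for some increasing $(m_n)$. Its topology is generated by the sets $\{x : K_1\subseteq x(0D_x)\subseteq\Lambda\setminus K_2\}$ with $K_1,K_2\subseteq\Lambda$ finite and $0D_x=\{(0,q)\in D_x\}$. For $(0,m)\in D_x$, $x\cdot m$ is the path $(p,q)\mapsto x(m+p,m+q)$, defined when $(m+p,m+q)\in D_x$. $\mathrm{PS_{Yee}}(\Lambda)$ is the set of graph morphisms $x:\Omega_{k,m}\to\Lambda$ with $m\in(\mathbb N\cup\{\infty\})^k$; put $d(x)=m$. For $p\in\mathbb N^k$ with $p\le d(x)$, $\sigma^px$ is the unique element of $\mathrm{PS_{Yee}}(\Lambda)$ with $d(\sigma^px)=d(x)-p$ and $(\sigma^px)(0,q)=x(p,p+q)$ for $q\le d(x)-p$. For $\lambda\in\Lambda$ with $s(\lambda)=x(0,0)$, $\lambda x$ is the element of $\mathrm{PS_{Yee}}(\Lambda)$ with $d(\lambda x)=d(\lambda)+d(x)$, $(\lambda x)(0,d(\lambda))=\lambda$ and $(\lambda x)(d(\lambda),d(\lambda)+p)=x(0,p)$ for $p\le d(x)$. *Path groupoids.*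 $\mathrm{PG_m}(\Lambda)$ is the set of $(x,q,y)\in \mathrm{PS_m}(\Lambda)\times\mathbb Z^k\times \mathrm{PS_m}(\Lambda)$ with $q=m-n$ and $x\cdot m=y\cdot n$ for some $m,n\in\mathbb N^k$, with the topology generated by the sets $\{(x,m-n,y): x\in U,\ y\in V,\ x\cdot m=y\cdot n\}$ with $U,V$ open in $\mathrm{PS_m}(\Lambda)$ and $m,n\in\mathbb N^k$. $\mathrm{PG_{Yee}}(\Lambda)$ is the corresponding set of triples for $\mathrm{PS_{Yee}}(\Lambda)$ and $\sigma$, with the topology generated by the sets $Z(A*_sB,n)\cap Z(F,n)^c$, where $n\in\mathbb Z^k$, $A,B\subseteq\Lambda$, $A*_sB=\{(\lambda,\mu)\in A\times B:s(\lambda)=s(\mu)\}$, $F\subseteq\Lambda*_s\Lambda$ is finite and $Z(F,n)=\{(\lambda x,d(\lambda)-d(\mu),\mu x):(\lambda,\mu)\in F,\ d(\lambda)-d(\mu)=n\}$. Both have the operations $(x,q,y)(y,r,z)=(x,q+r,z)$ and $(x,q,y)^{-1}=(y,-q,x)$. *Boundary paths.* $E\subseteq\Lambda$ is exhaustive if for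 every $\lambda$ with $r(\lambda)\in r(E)$ there is $\mu\in E$ with $\lambda\Lambda\cap\mu\Lambda\ne\emptyset$. $\mathrm{BPS_m}(\Lambda)$ is the set of $x\in \mathrm{PS_m}(\Lambda)$ such that, whenever $(0,m)\in D_x$, $E$ is finite and exhaustive and $s(x(0,m))\in r(E)$, there is $\nu\in E$ with $(m,m+d(\nu))\in D_x$ and $x(m,m+d(\nu))=\nu$. $\mathrm{BPS_{Yee}}(\Lambda)$ is the set of $x\in \mathrm{PS_{Yee}}(\Lambda)$ such that, for all $m\le d(x)$ in $\mathbb N^k$ and every finite $E\subseteq\Lambda$ with $x(m,m)\in r(E)$ such that each $\lambda$ with $r(\lambda)\in r(E)$ admits $\mu\in E$ and $\alpha,\beta\in\Lambda$ with $\lambda\alpha=\mu\beta$ and $d(\lambda\alpha)=d(\lambda)\vee d(\mu)$, there is $\nu\in E$ with $m+d(\nu)\le d(x)$ and $x(m,m+d(\nu))=\nu$. $\mathrm{BPG_m}(\Lambda)$ and $\mathrm{BPG_{Yee}}(\Lambda)$ are the reductions of $\mathrm{PG_m}(\Lambda)$ and $\mathrm{PG_{Yee}}(\Lambda)$ to the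 units $(x,0,x)$ with $x$ in $\mathrm{BPS_m}(\Lambda)$, respectively $\mathrm{BPS_{Yee}}(\Lambda)$, with the subspace topology. Then: 1. The $k$-graphs $\Omega_{\mathbb N^k,(m_n)}$, for increasing $(m_n)$, are exactly the $k$-graphs $\Omega_{k,m}$, for $m\in(\mathbb N\cup\{\infty\})^k$. Explicitly, $\Omega_{k,m}=\Omega_{\mathbb N^k,(m_n)}$ for the increasing sequence with $m_n(i)=m(i)$ if $m(i)<\infty$ and $m_n(i)=n$ ($n=0,1,2,\dots$) if $m(i)=\infty$; and $\Omega_{\mathbb N^k,(m_n)}=\Omega_{k,m}$ with $m(i)=\sup_n m_n(i)$. 2. $\mathrm{PS_m}(\Lambda)=\mathrm{PS_{Yee}}(\Lambda)$; the map $(x,m)\mapsto x\cdot m$ is a partial semigroup action of $\mathbb N^k$ on it (that is, $x\cdot 0=x$ is always defined, and $x\cdot(m+n)$ is defined if and only if $x\cdot m$ and $(x\cdot m)\cdot n$ are, and then equals $(x\cdot m)\cdot n$); $\sigma^px$ exists and is unique whenever $p\le d(x)$; and the actions coincide: $x\cdot p$ is defined if and only if $p\le d(x)$, and then $x\cdot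 p=\sigma^px$. 3. The generating sets given above are bases of the topologies of $\mathrm{PG_m}(\Lambda)$ and of $\mathrm{PG_{Yee}}(\Lambda)$; $\mathrm{PG_m}(\Lambda)$ is a topological groupoid; and $\mathrm{PG_m}(\Lambda)=\mathrm{PG_{Yee}}(\Lambda)$ as topological groupoids: same set, operations and topology. 4. $\mathrm{BPS_m}(\Lambda)=\mathrm{BPS_{Yee}}(\Lambda)$, $\mathrm{BPG_m}(\Lambda)$ is a topological groupoid, and $\mathrm{BPG_m}(\Lambda)=\mathrm{BPG_{Yee}}(\Lambda)$ as topological groupoids. -/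

import Mathlib

universe u

/-! ### Higher-rank graphs -/

/-- A (discrete) `k`-graph: a countable small category, given as in the theory of higher-rank
graphs by its set of morphisms (objects are identified with identity morphisms), with a degree
functor `d` to `ℕ^k` that has the unique factorisation property. The composite `comp a b` is
defined when `s a = r b`. -/
structure KGraph (k : ℕ) where
  Mor : Type u
  countable_mor : Countable Mor
  r : Mor → Mor
  s : Mor → Mor
  comp : (a b : Mor) → s a = r b → Mor
  r_r : ∀ a, r (r a) = r a
  s_r : ∀ a, s (r a) = r a
  r_s : ∀ a, r (s a) = s a
  s_s : ∀ a, s (s a) = s a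
  r_comp : ∀ a b h, r (comp a b h) = r a
  s_comp : ∀ a b h, s (comp a b h) = s b
  assoc : ∀ a b c (hab : s a = r b) (hbc : s b = r c),
    comp (comp a b hab) c ((s_comp a b hab).trans hbc) =
      comp a (comp b c hbc) (hab.trans (r_comp b c hbc).symm)
  id_comp : ∀ a, comp (r a) a (s_r a) = a
  comp_id : ∀ a, comp a (s a) (r_s a).symm = a
  d : Mor → (Fin k → ℕ)
  d_r : ∀ a, d (r a) = 0
  d_comp : ∀ a b h, d (comp a b h) = d a + d b
  factorisation : ∀ (a : Mor) (p q : Fin k → ℕ), d a = p + q →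
    ∃! bc : Mor × Mor, (∃ h : s bc.1 = r bc.2, comp bc.1 bc.2 h = a) ∧ d bc.1 = p ∧ d bc.2 = q

namespace KGraph

/-- `aΛ`, the set of all composites `ab`. -/
def extensions {k : ℕ} (Λ : KGraph.{u} k) (a : Λ.Mor) : Set Λ.Mor :=
  {c | ∃ (b : Λ.Mor) (h : Λ.s a = Λ.r b), Λ.comp a b h = c}

def FinitelyAligned {k : ℕ} (Λ : KGraph.{u} k) : Prop :=
  ∀ a b : Λ.Mor, ∃ J : Set Λ.Mor, J.Finite ∧
    Λ.extensions a ∩ Λ.extensions b = ⋃ c ∈ J, Λ.extensions c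

/-- A graph morphism: a degree-preserving functor. -/
structure IsGraphMorphism {k : ℕ} (Λ₁ : KGraph.{0} k) (Λ₂ : KGraph.{u} k)
    (f : Λ₁.Mor → Λ₂.Mor) : Prop where
  map_r : ∀ a, f (Λ₁.r a) = Λ₂.r (f a)
  map_s : ∀ a, f (Λ₁.s a) = Λ₂.s (f a)
  map_comp : ∀ a b (h : Λ₁.s a = Λ₁.r b) (h' : Λ₂.s (f a) = Λ₂.r (f b)),
    f (Λ₁.comp a b h) = Λ₂.comp (f a) (f b) h'
  map_d : ∀ a, Λ₂.d (f a) = Λ₁.d a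

end KGraph

/-! ### Path prototypes -/

/-- The sets of pairs on which the operations of the path prototypes make sense. -/
structure IsPrototypeSet {k : ℕ} (S : Set ((Fin k → ℕ) × (Fin k → ℕ))) : Prop where
  le : ∀ z ∈ S, z.1 ≤ z.2
  mem : ∀ z ∈ S, ∀ p q, p ≤ q → q ≤ z.2 → (p, q) ∈ S

/-- The `k`-graph with underlying set `S`, range `(p, p)` and source `(q, q)` of `(p, q)`,
composition `(p, q)(q, r) = (p, r)` and degree `q - p`. -/
def prototypeGraph {k : ℕ} (S : Set ((Fin k → ℕ) × (Fin k → ℕ))) (hS : IsPrototypeSet S) :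
    KGraph.{0} k where
  Mor := S
  countable_mor := inferInstance
  r z := ⟨(z.1.1, z.1.1), hS.mem _ z.2 _ _ le_rfl (hS.le _ z.2)⟩
  s z := ⟨(z.1.2, z.1.2), hS.mem _ z.2 _ _ le_rfl le_rfl⟩
  comp a b h := ⟨(a.1.1, b.1.2), hS.mem _ b.2 _ _
    ((hS.le _ a.2).trans
      ((congrArg (fun z : S => z.1.1) h).le.trans (hS.le _ b.2))) le_rfl⟩
  r_r _ := rfl
  s_r _ := rfl
  r_s _ := rfl
  s_s _ := rfl
  r_comp _ _ _ := rfl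
  s_comp _ _ _ := rfl
  assoc _ _ _ _ _ := rfl
  id_comp _ := rfl
  comp_id _ := rfl
  d z := z.1.2 - z.1.1
  d_r _ := by simp
  d_comp a b h := by
    have h1 : a.1.2 = b.1.1 := congrArg (fun z : S => z.1.1) h
    have h2 := hS.le _ a.2
    have h3 := hS.le _ b.2
    funext i
    have h4 : a.1.2 i = b.1.1 i := congrFun h1 i
    have h5 : a.1.1 i ≤ a.1.2 i := h2 i
    have h6 : b.1.1 i ≤ b.1.2 i := h3 i
    simp only [Pi.sub_apply, Pi.add_apply]
    omega
  factorisation := by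
    rintro ⟨⟨x, y⟩, hz⟩ p q hd
    have hle : x ≤ y := hS.le _ hz
    have hy : y = x + p + q := by
      funext i
      have h1 := congrFun hd i
      have h2 : x i ≤ y i := hle i
      simp only [Pi.sub_apply, Pi.add_apply] at h1 ⊢
      omega
    have hxp : x + p ≤ y := by
      rw [hy]; exact le_self_add
    refine ⟨(⟨(x, x + p), hS.mem _ hz _ _ le_self_add hxp⟩,
      ⟨(x + p, y), hS.mem _ hz _ _ hxp le_rfl⟩), ⟨⟨rfl, rfl⟩, ?_, ?_⟩, ?_⟩
    · funext i; simp
    · funext i; simp [hy]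
    · rintro ⟨⟨⟨a, b⟩, hb⟩, ⟨⟨c, e⟩, he⟩⟩ ⟨⟨h, hc⟩, h1, h2⟩
      have hab : a ≤ b := hS.le _ hb
      have hbc : b = c := congrArg (fun z : S => z.1.1) h
      have hax : a = x := congrArg (fun z : S => z.1.1) hc
      have hey : e = y := congrArg (fun z : S => z.1.2) hc
      have hbp : b = x + p := by
        funext i
        have h3 := congrFun h1 i
        have h4 : a i ≤ b i := hab i
        have h5 : a i = x i := congrFun hax i
        simp only [Pi.sub_apply, Pi.add_apply] at h3 ⊢
        omega
      subst hbc hax hey hbp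
      rfl

/-- The underlying set of `Ω_{ℕ^k, m}` for `m ∈ ℕ^k`. -/
def omegaSet {k : ℕ} (m : Fin k → ℕ) : Set ((Fin k → ℕ) × (Fin k → ℕ)) :=
  {z | z.1 ≤ z.2 ∧ z.2 ≤ m}

/-- The underlying set of the direct limit `Ω_{ℕ^k, (m_n)}`. -/
def omegaSeqSet {k : ℕ} (m : ℕ → Fin k → ℕ) : Set ((Fin k → ℕ) × (Fin k → ℕ)) :=
  ⋃ n, omegaSet (m n)

theorem omegaSeqSet_isPrototypeSet {k : ℕ} (m : ℕ → Fin k → ℕ) :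
    IsPrototypeSet (omegaSeqSet m) := by
  constructor
  · intro z hz
    obtain ⟨n, hn⟩ := Set.mem_iUnion.1 hz
    exact hn.1
  · intro z hz p q hpq hqz
    obtain ⟨n, hn⟩ := Set.mem_iUnion.1 hz
    exact Set.mem_iUnion.2 ⟨n, hpq, hqz.trans hn.2⟩

/-- The `P`-path prototype `Ω_{P, (m_n)}` for `P = ℕ^k` (used for increasing sequences). -/
def omegaSeq {k : ℕ} (m : ℕ → Fin k → ℕ) : KGraph.{0} k :=
  prototypeGraph (omegaSeqSet m) (omegaSeqSet_isPrototypeSet m)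

/-- `p ≤ m` for `p ∈ ℕ^k` and `m ∈ (ℕ ∪ {∞})^k`. -/
def LeDeg {k : ℕ} (p : Fin k → ℕ) (m : Fin k → ℕ∞) : Prop :=
  ∀ i, (p i : ℕ∞) ≤ m i

/-- The underlying set of Yeend's `Ω_{k, m}` for `m ∈ (ℕ ∪ {∞})^k`. -/
def yeeOmegaSet {k : ℕ} (m : Fin k → ℕ∞) : Set ((Fin k → ℕ) × (Fin k → ℕ)) :=
  {z | z.1 ≤ z.2 ∧ LeDeg z.2 m}

theorem yeeOmegaSet_isPrototypeSet {k : ℕ} (m : Fin k → ℕ∞) :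
    IsPrototypeSet (yeeOmegaSet m) := by
  constructor
  · intro z hz
    exact hz.1
  · intro z hz p q hpq hqz
    exact ⟨hpq, fun i => (Nat.cast_le.2 (hqz i)).trans (hz.2 i)⟩

/-- Yeend's rank-`k` path prototype `Ω_{k, m}`. -/
def yeeOmega {k : ℕ} (m : Fin k → ℕ∞) : KGraph.{0} k :=
  prototypeGraph (yeeOmegaSet m) (yeeOmegaSet_isPrototypeSet m)

/-! ### Path spaces -/

/-- Partial maps from `ℕ^k × ℕ^k` to `Λ`. A map `Ω → Λ` defined on a path prototype is such a
partial map with domain `Ω`; two of them are equal when domains and values agree. -/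
abbrev PartialPath {k : ℕ} (Λ : KGraph.{u} k) : Type u :=
  ((Fin k → ℕ) × (Fin k → ℕ)) →. Λ.Mor

/-- `x` has domain `S` and is a graph morphism from the prototype on `S` to `Λ`. -/
def IsMorphismOn {k : ℕ} (Λ : KGraph.{u} k) (S : Set ((Fin k → ℕ) × (Fin k → ℕ)))
    (hS : IsPrototypeSet S) (x : PartialPath Λ) : Prop :=
  ∃ h : x.Dom = S, KGraph.IsGraphMorphism (prototypeGraph S hS) Λ
    (fun z : S => (x z.1).get (h.symm.subset z.2))

/-- The path space of graph morphisms `x : Ω_{ℕ^k, (m_n)} → Λ`. -/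
def PSm {k : ℕ} (Λ : KGraph.{u} k) : Set (PartialPath Λ) :=
  {x | ∃ m : ℕ → Fin k → ℕ, Monotone m ∧
    IsMorphismOn Λ (omegaSeqSet m) (omegaSeqSet_isPrototypeSet m) x}

/-- `x` is a graph morphism `Ω_{k, m} → Λ`, that is, a path of degree `d(x) = m`. -/
def HasDegree {k : ℕ} (Λ : KGraph.{u} k) (x : PartialPath Λ) (m : Fin k → ℕ∞) : Prop :=
  IsMorphismOn Λ (yeeOmegaSet m) (yeeOmegaSet_isPrototypeSet m) x

/-- Yeend's path space. -/
def PSYee {k : ℕ} (Λ : KGraph.{u} k) : Set (PartialPath Λ) :=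
  {x | ∃ m : Fin k → ℕ∞, HasDegree Λ x m}

/-- The set of values `x(0, q)` of `x` at pairs whose first entry is `0`. -/
def initialSegments {k : ℕ} (Λ : KGraph.{u} k) (x : PartialPath Λ) : Set Λ.Mor :=
  {a | ∃ q, a ∈ x (0, q)}

/-- The basic open sets of the path space of graph morphisms. -/
def fellSet {k : ℕ} (Λ : KGraph.{u} k) (K₁ K₂ : Set Λ.Mor) : Set (PSm Λ) :=
  {x | K₁ ⊆ initialSegments Λ x.1 ∧ initialSegments Λ x.1 ⊆ K₂ᶜ}

@[reducible] def topPSm {k : ℕ} (Λ : KGraph.{u} k) : TopologicalSpace (PSm Λ) :=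
  TopologicalSpace.generateFrom
    {U | ∃ K₁ K₂ : Set Λ.Mor, K₁.Finite ∧ K₂.Finite ∧ U = fellSet Λ K₁ K₂}

/-! ### Partial actions of `ℕ^k` -/

/-- A subset `carrier` of `α` with a partially defined map `(x, m) ↦ x · m`. -/
structure PartialAction (k : ℕ) (α : Type u) where
  carrier : Set α
  act : α × (Fin k → ℕ) →. α

/-- The partially defined map is a semigroup action of `ℕ^k` on the carrier. -/
structure IsSemigroupAction {k : ℕ} {α : Type u} (T : PartialAction k α) : Prop where
  mem_of_dom : ∀ x m, (T.act (x, m)).Dom → x ∈ T.carrier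
  mem_of_act : ∀ x m, ∀ y ∈ T.act (x, m), y ∈ T.carrier
  act_zero : ∀ x ∈ T.carrier, x ∈ T.act (x, 0)
  dom_add : ∀ x ∈ T.carrier, ∀ m n,
    (T.act (x, m + n)).Dom ↔ ∃ y ∈ T.act (x, m), (T.act (y, n)).Dom
  act_add : ∀ x ∈ T.carrier, ∀ m n, ∀ y ∈ T.act (x, m), ∀ z ∈ T.act (y, n),
    z ∈ T.act (x, m + n)

/-- The shift action on the path space of graph morphisms: `x · m` is defined when `(0, m)` is in
the domain of `x`, and `(x · m)(p, q) = x(m + p, m + q)`. -/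
def actM {k : ℕ} (Λ : KGraph.{u} k) : PartialAction k (PartialPath Λ) where
  carrier := PSm Λ
  act := fun z => ⟨z.1 ∈ PSm Λ ∧ (z.1 (0, z.2)).Dom,
    fun _ => fun pq => z.1 (z.2 + pq.1, z.2 + pq.2)⟩

/-- The properties that single out `y = σ^p x`: the path `y` has degree `d(x) - p`, and
`y(0, q) = x(p, p + q)` for all `q ≤ d(x) - p`. -/
def IsYeeShift {k : ℕ} (Λ : KGraph.{u} k) (p : Fin k → ℕ) (x y : PartialPath Λ) : Prop :=
  ∃ m : Fin k → ℕ∞, HasDegree Λ x m ∧ LeDeg p m ∧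
    HasDegree Λ y (fun i => m i - (p i : ℕ∞)) ∧
    ∀ q : Fin k → ℕ, LeDeg q (fun i => m i - (p i : ℕ∞)) → y (0, q) = x (p, p + q)

/-- Yeend's shift action: `σ^p x` is defined when `p ≤ d(x)`, and it is then the path singled out
by `IsYeeShift`. -/
noncomputable def actYee {k : ℕ} (Λ : KGraph.{u} k) : PartialAction k (PartialPath Λ) where
  carrier := PSYee Λ
  act := fun z => ⟨∃ m : Fin k → ℕ∞, HasDegree Λ z.1 m ∧ LeDeg z.2 m,
    fun _ => Classical.epsilon (IsYeeShift Λ z.2 z.1)⟩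

/-! ### Topological groupoids -/

/-- A subset of `α` with a partially defined composition, an inversion and a topology. -/
structure GroupoidData (α : Type u) where
  carrier : Set α
  comp : α × α →. α
  inv : α →. α
  topology : TopologicalSpace carrier

namespace GroupoidData

/-- The axioms of a groupoid. -/
structure IsGroupoid {α : Type u} (G : GroupoidData α) : Prop where
  comp_mem : ∀ g h, ∀ c ∈ G.comp (g, h), g ∈ G.carrier ∧ h ∈ G.carrier ∧ c ∈ G.carrier
  inv_dom : ∀ g, (G.inv g).Dom ↔ g ∈ G.carrier
  inv_mem : ∀ g, ∀ g' ∈ G.inv g, g' ∈ G.carrier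
  assoc : ∀ f g h, ∀ a ∈ G.comp (f, g), ∀ b ∈ G.comp (g, h),
    ∃ c, c ∈ G.comp (f, b) ∧ c ∈ G.comp (a, h)
  inv_inv : ∀ g, ∀ g' ∈ G.inv g, g ∈ G.inv g'
  inv_comp_dom : ∀ g, ∀ g' ∈ G.inv g, (G.comp (g', g)).Dom
  inv_comp_cancel : ∀ g h, ∀ g' ∈ G.inv g, ∀ c ∈ G.comp (g, h), h ∈ G.comp (g', c)
  comp_inv_cancel : ∀ g h, ∀ h' ∈ G.inv h, ∀ c ∈ G.comp (g, h), g ∈ G.comp (c, h')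

/-- The set of composable pairs. -/
def composablePairs {α : Type u} (G : GroupoidData α) : Set (G.carrier × G.carrier) :=
  {z | (G.comp (z.1.1, z.2.1)).Dom}

/-- A groupoid whose composition (on the composable pairs, with the subspace topology of the
product topology) and inversion are continuous; continuity is openness of preimages. -/
structure IsTopologicalGroupoid {α : Type u} (G : GroupoidData α) : Prop where
  isGroupoid : G.IsGroupoid
  continuous_comp : letI := G.topology
    ∀ W : Set G.carrier, IsOpen W →
      IsOpen {z : G.composablePairs | ∃ c ∈ W, c.1 ∈ G.comp (z.1.1.1, z.1.2.1)}
  continuous_inv : letI := G.topology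
    ∀ W : Set G.carrier, IsOpen W → IsOpen {g : G.carrier | ∃ c ∈ W, c.1 ∈ G.inv g.1}

/-- The underlying set `s⁻¹(U) ∩ r⁻¹(U)` of a reduction, where `s(g) = g⁻¹g` and `r(g) = gg⁻¹`. -/
def reductionCarrier {α : Type u} (G : GroupoidData α) (U : Set α) : Set α :=
  {g | g ∈ G.carrier ∧ ∃ g' ∈ G.inv g, (∃ v ∈ G.comp (g', g), v ∈ U) ∧
    ∃ w ∈ G.comp (g, g'), w ∈ U}

/-- The reduction of `G` to a set `U` of units, with the inherited operations and topology. -/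
def reduction {α : Type u} (G : GroupoidData α) (U : Set α) : GroupoidData α where
  carrier := G.reductionCarrier U
  comp := fun z => ⟨z.1 ∈ G.reductionCarrier U ∧ z.2 ∈ G.reductionCarrier U ∧ (G.comp z).Dom,
    fun h => (G.comp z).get h.2.2⟩
  inv := fun g => ⟨g ∈ G.reductionCarrier U ∧ (G.inv g).Dom, fun h => (G.inv g).get h.2⟩
  topology := TopologicalSpace.induced
    (fun g : G.reductionCarrier U => (⟨g.1, g.2.1⟩ : G.carrier)) G.topology

end GroupoidData

/-- The difference `m - n` in `ℤ^k` of `m, n ∈ ℕ^k`. -/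
def degDiff {k : ℕ} (m n : Fin k → ℕ) : Fin k → ℤ :=
  fun i => (m i : ℤ) - (n i : ℤ)

/-- A set of triples with the operations `(x, q, y)(y, r, z) = (x, q + r, z)` and
`(x, q, y)⁻¹ = (y, -q, x)` and a given topology. -/
def tripleGroupoid {k : ℕ} {α : Type u} (C : Set (α × (Fin k → ℤ) × α))
    (τ : TopologicalSpace C) : GroupoidData (α × (Fin k → ℤ) × α) where
  carrier := C
  comp := fun z => ⟨z.1 ∈ C ∧ z.2 ∈ C ∧ z.1.2.2 = z.2.1,
    fun _ => (z.1.1, z.1.2.1 + z.2.2.1, z.2.2.2)⟩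
  inv := fun g => ⟨g ∈ C, fun _ => (g.2.2, -g.2.1, g.1)⟩
  topology := τ

/-- The set of `(x, q, y)` such that `q = m - n` and `x · m = y · n` for some `m, n ∈ ℕ^k`. -/
def actionTriples {k : ℕ} {α : Type u} (T : PartialAction k α) :
    Set (α × (Fin k → ℤ) × α) :=
  {g | g.1 ∈ T.carrier ∧ g.2.2 ∈ T.carrier ∧
    ∃ m n : Fin k → ℕ, g.2.1 = degDiff m n ∧ ∃ z, z ∈ T.act (g.1, m) ∧ z ∈ T.act (g.2.2, n)}

/-- The set of `(x, m - n, y)` with `x ∈ U`, `y ∈ V` and `x · m = y · n`. -/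
def cylinder {k : ℕ} {α : Type u} (T : PartialAction k α) (U : Set T.carrier)
    (m n : Fin k → ℕ) (V : Set T.carrier) : Set (actionTriples T) :=
  {g | g.1.2.1 = degDiff m n ∧ (∃ x ∈ U, x.1 = g.1.1) ∧ (∃ y ∈ V, y.1 = g.1.2.2) ∧
    ∃ z, z ∈ T.act (g.1.1, m) ∧ z ∈ T.act (g.1.2.2, n)}

def cylinders {k : ℕ} {α : Type u} (T : PartialAction k α) (τ : TopologicalSpace T.carrier) :
    Set (Set (actionTriples T)) :=
  {W | ∃ (U V : Set T.carrier) (m n : Fin k → ℕ),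
    @IsOpen _ τ U ∧ @IsOpen _ τ V ∧ W = cylinder T U m n V}

/-- The semidirect product groupoid of an action on a topological space. -/
def semidirectProduct {k : ℕ} {α : Type u} (T : PartialAction k α)
    (τ : TopologicalSpace T.carrier) : GroupoidData (α × (Fin k → ℤ) × α) :=
  tripleGroupoid (actionTriples T) (TopologicalSpace.generateFrom (cylinders T τ))

/-! ### The path groupoids -/

/-- The path groupoid of graph morphisms. -/
def PGm {k : ℕ} (Λ : KGraph.{u} k) :
    GroupoidData (PartialPath Λ × (Fin k → ℤ) × PartialPath Λ) :=
  semidirectProduct (actM Λ) (topPSm Λ)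

/-- The properties that single out `y = ax` for a morphism `a` and a path `x` with
`s(a) = r(x) = x(0, 0)`: the path `y` has degree `d(a) + d(x)`, `y(0, d(a)) = a` and
`y(d(a), d(a) + p) = x(0, p)` for all `p ≤ d(x)`. -/
def IsYeeConcat {k : ℕ} (Λ : KGraph.{u} k) (a : Λ.Mor) (x y : PartialPath Λ) : Prop :=
  ∃ m : Fin k → ℕ∞, HasDegree Λ x m ∧ Λ.s a ∈ x (0, 0) ∧
    HasDegree Λ y (fun i => (Λ.d a i : ℕ∞) + m i) ∧ a ∈ y (0, Λ.d a) ∧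
    ∀ p : Fin k → ℕ, LeDeg p m → y (Λ.d a, Λ.d a + p) = x (0, p)

/-- The pairs in `A × B` with equal sources. -/
def sourcePairs {k : ℕ} (Λ : KGraph.{u} k) (A B : Set Λ.Mor) : Set (Λ.Mor × Λ.Mor) :=
  {z | z.1 ∈ A ∧ z.2 ∈ B ∧ Λ.s z.1 = Λ.s z.2}

/-- Yeend's set `Z(F, n)` of all `(ax, d(a) - d(b), bx)` with `(a, b) ∈ F` and
`d(a) - d(b) = n`. -/
def yeeZ {k : ℕ} (Λ : KGraph.{u} k) (F : Set (Λ.Mor × Λ.Mor)) (n : Fin k → ℤ) :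
    Set (actionTriples (actYee Λ)) :=
  {g | ∃ (a b : Λ.Mor) (x : PartialPath Λ), (a, b) ∈ F ∧ degDiff (Λ.d a) (Λ.d b) = n ∧
    IsYeeConcat Λ a x g.1.1 ∧ g.1.2.1 = degDiff (Λ.d a) (Λ.d b) ∧ IsYeeConcat Λ b x g.1.2.2}

/-- Yeend's basic open sets `Z(A *ₛ B, n) ∩ Z(F, n)ᶜ`. -/
def yeeBasis {k : ℕ} (Λ : KGraph.{u} k) : Set (Set (actionTriples (actYee Λ))) :=
  {W | ∃ (n : Fin k → ℤ) (A B : Set Λ.Mor) (F : Set (Λ.Mor × Λ.Mor)),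
    F.Finite ∧ F ⊆ sourcePairs Λ Set.univ Set.univ ∧
    W = yeeZ Λ (sourcePairs Λ A B) n ∩ (yeeZ Λ F n)ᶜ}

/-- Yeend's path groupoid. -/
noncomputable def PGYee {k : ℕ} (Λ : KGraph.{u} k) :
    GroupoidData (PartialPath Λ × (Fin k → ℤ) × PartialPath Λ) :=
  tripleGroupoid (actionTriples (actYee Λ)) (TopologicalSpace.generateFrom (yeeBasis Λ))

/-! ### The boundary-path groupoids -/

/-- `E` is exhaustive: every morphism with range in `r(E)` has a common extension with some
element of `E`. -/
def Exhaustive {k : ℕ} (Λ : KGraph.{u} k) (E : Set Λ.Mor) : Prop :=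
  ∀ a, Λ.r a ∈ Λ.r '' E → ∃ b ∈ E, (Λ.extensions a ∩ Λ.extensions b).Nonempty

/-- The boundary-path space of graph morphisms. -/
def BPSm {k : ℕ} (Λ : KGraph.{u} k) : Set (PartialPath Λ) :=
  {x | x ∈ PSm Λ ∧ ∀ (m : Fin k → ℕ) (E : Set Λ.Mor), ∀ a ∈ x (0, m),
    E.Finite → Exhaustive Λ E → Λ.s a ∈ Λ.r '' E → ∃ b ∈ E, b ∈ x (m, m + Λ.d b)}

/-- `Λ^min(a, b)`: the pairs `(c, e)` with `ac = be` of degree `d(a) ∨ d(b)`. -/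
def minCommonExtensions {k : ℕ} (Λ : KGraph.{u} k) (a b : Λ.Mor) : Set (Λ.Mor × Λ.Mor) :=
  {z | ∃ (h₁ : Λ.s a = Λ.r z.1) (h₂ : Λ.s b = Λ.r z.2),
    Λ.comp a z.1 h₁ = Λ.comp b z.2 h₂ ∧ Λ.d (Λ.comp a z.1 h₁) = Λ.d a ⊔ Λ.d b}

/-- Yeend's `v CE(Λ)` in the discrete case: the finite sets `E` with `v ∈ r(E)` that are
exhaustive for `r(E)`. -/
def yeeCE {k : ℕ} (Λ : KGraph.{u} k) (v : Λ.Mor) : Set (Set Λ.Mor) :=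
  {E | E.Finite ∧ v ∈ Λ.r '' E ∧
    ∀ a, Λ.r a ∈ Λ.r '' E → ∃ b ∈ E, (minCommonExtensions Λ a b).Nonempty}

/-- Yeend's boundary-path space. -/
def BPSYee {k : ℕ} (Λ : KGraph.{u} k) : Set (PartialPath Λ) :=
  {x | ∃ dx : Fin k → ℕ∞, HasDegree Λ x dx ∧ ∀ m : Fin k → ℕ, LeDeg m dx →
    ∀ v ∈ x (m, m), ∀ E ∈ yeeCE Λ v, ∃ b ∈ E, b ∈ x (m, m + Λ.d b)}

/-- The units `(x, 0, x)` with `x ∈ X`. -/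
def unitTriples {k : ℕ} {α : Type u} (X : Set α) : Set (α × (Fin k → ℤ) × α) :=
  {g | ∃ x ∈ X, g = (x, 0, x)}

/-- The boundary-path groupoid of graph morphisms. -/
def BPGm {k : ℕ} (Λ : KGraph.{u} k) :
    GroupoidData (PartialPath Λ × (Fin k → ℤ) × PartialPath Λ) :=
  (PGm Λ).reduction (unitTriples (BPSm Λ))

/-- Yeend's boundary-path groupoid. -/
noncomputable def BPGYee {k : ℕ} (Λ : KGraph.{u} k) :
    GroupoidData (PartialPath Λ × (Fin k → ℤ) × PartialPath Λ) :=
  (PGYee Λ).reduction (unitTriples (BPSYee Λ))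

/-! An increasing sequence in ℕ^k has a supremum in (ℕ ∪ {∞})^k, and because there are only finitely
many coordinates the elements of ℕ^k below the supremum are those below some term. So both kinds of
prototype are the same sets. By unique factorisation, every factor of a value of a path is again a
value (`IsPath.factor_mem`), and a path is determined by its initial segments x(0, q). Hence σ^p x
can only be the shift of x, and λx can only be the path that begins with λ and shifts to x.

The groupoids are compared through the relation `Coterminal a b x y`, that is, x = az and y = bz for
one z. The sets `coterminalSet Λ a b` of triples (az, d(a) - d(b), bz) are the building blocks of
both topologies. A pair (a, b) can be lengthened to (ac, bc) along x and y, and two such sets that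
share a point are nested once the degrees of their first segments are comparable
(`coterminalSet_subset`). This yields the bases, the continuity of multiplication after matching
middle segments, and the closedness of coterminal sets in PG_m. Hence Yeend's basic sets are open in
PG_m.

The converse needs the range and source maps to be continuous for Yeend's topology, and this is
where finite alignment enters. If aΛ ∩ cΛ is the union of the sets jΛ with j in a finite set J, then
among the paths az those that begin with c are those that begin with some j in J
(`exists_finite_pairs`). The condition is therefore clopen on each coterminal set.

For boundary paths, a common extension of a and b can be truncated at degree d(a) ∨ d(b). The two
notions of exhaustiveness agree, and so do the reductions. -/

open scoped Topology

/-! ### Cancellation and factorisation in a k-graph -/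

namespace KGraph

variable {k : ℕ} (Λ : KGraph.{u} k)

/-- Cancelling in ℕ^k makes the second factors agree in degree as well, so both pairs are the unique
factorisation of one morphism for one splitting of its degree. -/
theorem comp_inj {a b a' b' : Λ.Mor} (h : Λ.s a = Λ.r b) (h' : Λ.s a' = Λ.r b')
    (hc : Λ.comp a b h = Λ.comp a' b' h') (hd : Λ.d a = Λ.d a') : a = a' ∧ b = b' := by
  have e : Λ.d b = Λ.d b' := by
    have := congrArg Λ.d hc
    rw [Λ.d_comp, Λ.d_comp, hd] at this
    exact add_left_cancel this
  have hu := (Λ.factorisation (Λ.comp a b h) _ _ (Λ.d_comp a b h)).unique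
    (y₁ := (a, b)) (y₂ := (a', b')) ⟨⟨h, rfl⟩, rfl, rfl⟩ ⟨⟨h', hc.symm⟩, hd.symm, e.symm⟩
  exact ⟨congrArg Prod.fst hu, congrArg Prod.snd hu⟩

theorem exists_factor (c : Λ.Mor) {p : Fin k → ℕ} (hp : p ≤ Λ.d c) :
    ∃ a b, ∃ h : Λ.s a = Λ.r b, Λ.comp a b h = c ∧ Λ.d a = p := by
  obtain ⟨⟨a, b⟩, ⟨⟨h, hc⟩, ha, -⟩, -⟩ :=
    Λ.factorisation c p (Λ.d c - p) (add_tsub_cancel_of_le hp).symm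
  exact ⟨a, b, h, hc, ha⟩

theorem self_mem_extensions (a : Λ.Mor) : a ∈ Λ.extensions a :=
  ⟨Λ.s a, (Λ.r_s a).symm, Λ.comp_id a⟩

theorem d_le_of_mem_extensions {a c : Λ.Mor} (h : c ∈ Λ.extensions a) : Λ.d a ≤ Λ.d c := by
  obtain ⟨b, h, rfl⟩ := h
  rw [Λ.d_comp]
  exact le_self_add

/-- If `c` extends `a`, so does every initial segment of `c` of degree at least `d(a)`. -/
theorem mem_extensions_of_le {a b c : Λ.Mor} (ha : c ∈ Λ.extensions a)
    (hb : c ∈ Λ.extensions b) (h : Λ.d a ≤ Λ.d b) : b ∈ Λ.extensions a := by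
  obtain ⟨e, he, rfl⟩ := ha
  obtain ⟨f, hf, hc⟩ := hb
  -- Write b = a'g with d(a') = d(a). Then ae = bf = a'(gf), and cancellation forces a' = a.
  obtain ⟨a', g, hg, rfl, hd⟩ := Λ.exists_factor b h
  have hgf : Λ.s g = Λ.r f := by rw [← hf, Λ.s_comp]
  have h1 := Λ.assoc a' g f hg hgf
  rw [hc] at h1
  obtain ⟨rfl, -⟩ := Λ.comp_inj _ _ h1 hd.symm
  exact ⟨g, hg, rfl⟩

end KGraph

/-! ### Path prototypes -/

section Prototypes

variable {k : ℕ}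

theorem prototypeGraph_congr {S S' : Set ((Fin k → ℕ) × (Fin k → ℕ))} (h : S = S')
    (hS : IsPrototypeSet S) (hS' : IsPrototypeSet S') :
    prototypeGraph S hS = prototypeGraph S' hS' := by
  subst h
  rfl

theorem exists_le_of_leDeg_iSup {m : ℕ → Fin k → ℕ} (hm : Monotone m) {q : Fin k → ℕ}
    (hq : LeDeg q (fun i => ⨆ n, (m n i : ℕ∞))) : ∃ n, q ≤ m n := by
  have h : ∀ i, ∃ n, q i ≤ m n i := by
    intro i
    by_contra! hc
    -- The truncated `q i - 1` is a genuine predecessor: `hc 0` shows that `q i` is positive.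
    have h1 : (⨆ n, (m n i : ℕ∞)) ≤ ((q i - 1 : ℕ) : ℕ∞) :=
      iSup_le fun n => Nat.cast_le.2 (Nat.le_sub_one_of_lt (hc n))
    have h2 : q i ≤ q i - 1 := Nat.cast_le.1 ((hq i).trans h1)
    have := hc 0
    omega
  choose N hN using h
  exact ⟨Finset.univ.sup N, fun i =>
    (hN i).trans (hm (Finset.le_sup (Finset.mem_univ i)) i)⟩

theorem omegaSeqSet_eq {m : ℕ → Fin k → ℕ} (hm : Monotone m) :
    omegaSeqSet m = yeeOmegaSet (fun i => ⨆ n, (m n i : ℕ∞)) := by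
  ext z
  simp only [omegaSeqSet, omegaSet, yeeOmegaSet, Set.mem_iUnion, Set.mem_ofPred_eq]
  constructor
  · rintro ⟨n, h1, h2⟩
    exact ⟨h1, fun i => (Nat.cast_le.2 (h2 i)).trans (le_iSup (fun n => (m n i : ℕ∞)) n)⟩
  · rintro ⟨h1, h2⟩
    obtain ⟨n, hn⟩ := exists_le_of_leDeg_iSup hm h2
    exact ⟨n, h1, hn⟩

theorem truncation_monotone (m : Fin k → ℕ∞) :
    Monotone (fun (n : ℕ) (i : Fin k) => if m i = ⊤ then n else (m i).toNat) := by
  intro a b hab i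
  dsimp only
  split_ifs
  · exact hab
  · exact le_rfl

theorem yeeOmegaSet_eq (m : Fin k → ℕ∞) :
    yeeOmegaSet m =
      omegaSeqSet (fun (n : ℕ) (i : Fin k) => if m i = ⊤ then n else (m i).toNat) := by
  ext z
  simp only [omegaSeqSet, omegaSet, yeeOmegaSet, Set.mem_iUnion, Set.mem_ofPred_eq]
  constructor
  · rintro ⟨h1, h2⟩
    -- The index only has to dominate the infinite coordinates, so the largest entry of `z.2`
    -- suffices.
    refine ⟨Finset.univ.sup z.2, h1, fun i => ?_⟩
    dsimp only
    split_ifs with h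
    · exact Finset.le_sup (f := z.2) (Finset.mem_univ i)
    · have := h2 i
      rw [← ENat.natCast_toNat h] at this
      exact Nat.cast_le.1 this
  · rintro ⟨n, h1, h2⟩
    refine ⟨h1, fun i => ?_⟩
    have h3 := h2 i
    dsimp only at h3
    split_ifs at h3 with h
    · rw [h]; exact le_top
    · rw [← ENat.natCast_toNat h]
      exact Nat.cast_le.2 h3

theorem omegaSeq_eq_yeeOmega {m : ℕ → Fin k → ℕ} (hm : Monotone m) :
    omegaSeq m = yeeOmega (fun i => ⨆ n, (m n i : ℕ∞)) :=
  prototypeGraph_congr (omegaSeqSet_eq hm) _ _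

theorem yeeOmega_eq_omegaSeq (m : Fin k → ℕ∞) :
    yeeOmega m =
      omegaSeq (fun (n : ℕ) (i : Fin k) => if m i = ⊤ then n else (m i).toNat) :=
  prototypeGraph_congr (yeeOmegaSet_eq m) _ _

theorem LeDeg.mono {p q : Fin k → ℕ} {m : Fin k → ℕ∞} (hq : LeDeg q m) (h : p ≤ q) :
    LeDeg p m :=
  fun i => (Nat.cast_le.2 (h i)).trans (hq i)

theorem LeDeg.sup {p q : Fin k → ℕ} {m : Fin k → ℕ∞} (hp : LeDeg p m) (hq : LeDeg q m) :
    LeDeg (p ⊔ q) m := by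
  intro i
  rcases le_total (p i) (q i) with h | h
  · simpa [h] using hq i
  · simpa [h] using hp i

/-- Subtraction in ℕ∞ is truncated, so the condition on p is needed separately. Cancelling p is
legitimate because its coordinates are finite. -/
theorem leDeg_add_iff {p q : Fin k → ℕ} {m : Fin k → ℕ∞} :
    LeDeg (p + q) m ↔ LeDeg p m ∧ LeDeg q (fun i => m i - (p i : ℕ∞)) := by
  constructor
  · intro h
    refine ⟨h.mono le_self_add, fun i => ?_⟩
    have := h i
    rw [Pi.add_apply, Nat.cast_add] at this
    exact ENat.le_sub_of_add_le_left (ENat.natCast_ne_top _) this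
  · rintro ⟨h1, h2⟩ i
    rw [Pi.add_apply, Nat.cast_add]
    calc (p i : ℕ∞) + q i ≤ p i + (m i - p i) := by gcongr; exact h2 i
      _ = m i := add_tsub_cancel_of_le (h1 i)

end Prototypes

/-! ### Paths -/

/-- `x` is a path of degree `m`, in terms of membership. -/
structure IsPath {k : ℕ} (Λ : KGraph.{u} k) (x : PartialPath Λ) (m : Fin k → ℕ∞) : Prop where
  dom_iff : ∀ p q, (x (p, q)).Dom ↔ p ≤ q ∧ LeDeg q m
  r_mem : ∀ {p q a}, a ∈ x (p, q) → Λ.r a ∈ x (p, p)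
  s_mem : ∀ {p q a}, a ∈ x (p, q) → Λ.s a ∈ x (q, q)
  comp_mem : ∀ {p q t a b}, a ∈ x (p, q) → b ∈ x (q, t) →
    ∃ h : Λ.s a = Λ.r b, Λ.comp a b h ∈ x (p, t)
  d_eq : ∀ {p q a}, a ∈ x (p, q) → Λ.d a = q - p

/-- Membership in `Part` values replaces `Part.get` and its domain proofs. Composability comes for
free, since s(a) and r(b) are both the value at the vertex (q, q). -/
theorem hasDegree_iff_isPath {k : ℕ} {Λ : KGraph.{u} k} {x : PartialPath Λ} {m : Fin k → ℕ∞} :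
    HasDegree Λ x m ↔ IsPath Λ x m := by
  constructor
  · rintro ⟨h, hx⟩
    have key : ∀ {p q a}, a ∈ x (p, q) → ∃ hz : (p, q) ∈ yeeOmegaSet m,
        (x (p, q)).get (h.symm.subset hz) = a := by
      intro p q a ha
      obtain ⟨hd, rfl⟩ := ha
      exact ⟨h.subset hd, rfl⟩
    have hr : ∀ {p q a}, a ∈ x (p, q) → Λ.r a ∈ x (p, p) := by
      intro p q a ha
      obtain ⟨hz, rfl⟩ := key ha
      rw [← hx.map_r ⟨(p, q), hz⟩]
      exact Part.get_mem _
    have hs : ∀ {p q a}, a ∈ x (p, q) → Λ.s a ∈ x (q, q) := by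
      intro p q a ha
      obtain ⟨hz, rfl⟩ := key ha
      rw [← hx.map_s ⟨(p, q), hz⟩]
      exact Part.get_mem _
    refine ⟨fun p q => Set.ext_iff.1 h (p, q), hr, hs, ?_, ?_⟩
    · intro p q t a b ha hb
      have hab : Λ.s a = Λ.r b := Part.mem_unique (hs ha) (hr hb)
      refine ⟨hab, ?_⟩
      obtain ⟨hz, rfl⟩ := key ha
      obtain ⟨hw, rfl⟩ := key hb
      rw [← hx.map_comp ⟨(p, q), hz⟩ ⟨(q, t), hw⟩ rfl hab]
      exact Part.get_mem _
    · intro p q a ha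
      obtain ⟨hz, rfl⟩ := key ha
      exact hx.map_d ⟨(p, q), hz⟩
  · intro hx
    have h : x.Dom = yeeOmegaSet m := Set.ext fun z => hx.dom_iff z.1 z.2
    refine ⟨h, ?_, ?_, ?_, ?_⟩
    · intro a
      exact Part.mem_unique (Part.get_mem _) (hx.r_mem (Part.get_mem (h.symm.subset a.2)))
    · intro a
      exact Part.mem_unique (Part.get_mem _) (hx.s_mem (Part.get_mem (h.symm.subset a.2)))
    · rintro ⟨⟨p, q⟩, ha⟩ ⟨⟨q', t⟩, hb⟩ hab h'
      obtain rfl : q = q' := congrArg (fun z : yeeOmegaSet m => z.1.1) hab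
      exact Part.mem_unique (Part.get_mem _)
        (hx.comp_mem (Part.get_mem (h.symm.subset ha)) (Part.get_mem (h.symm.subset hb))).2
    · intro a
      exact hx.d_eq (Part.get_mem (h.symm.subset a.2))

theorem IsMorphismOn.congr {k : ℕ} {Λ : KGraph.{u} k} {x : PartialPath Λ}
    {S S' : Set ((Fin k → ℕ) × (Fin k → ℕ))} (h : S = S') {hS : IsPrototypeSet S}
    (hS' : IsPrototypeSet S') (hx : IsMorphismOn Λ S hS x) : IsMorphismOn Λ S' hS' x := by
  subst h
  exact hx

theorem PSm_eq_PSYee {k : ℕ} (Λ : KGraph.{u} k) : PSm Λ = PSYee Λ := by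
  ext x
  constructor
  · rintro ⟨m, hm, hx⟩
    exact ⟨_, hx.congr (omegaSeqSet_eq hm) (yeeOmegaSet_isPrototypeSet _)⟩
  · rintro ⟨m, hx⟩
    exact ⟨_, truncation_monotone m,
      IsMorphismOn.congr (yeeOmegaSet_eq m) (omegaSeqSet_isPrototypeSet _) hx⟩

theorem mem_PSm_iff {k : ℕ} {Λ : KGraph.{u} k} {x : PartialPath Λ} :
    x ∈ PSm Λ ↔ ∃ m, IsPath Λ x m := by
  rw [PSm_eq_PSYee]
  exact exists_congr fun m => hasDegree_iff_isPath

/-- The shifted path `(p, q) ↦ x(m + p, m + q)`. -/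
def shift {k : ℕ} {Λ : KGraph.{u} k} (x : PartialPath Λ) (m : Fin k → ℕ) : PartialPath Λ :=
  fun pq => x (m + pq.1, m + pq.2)

theorem shift_apply {k : ℕ} {Λ : KGraph.{u} k} (x : PartialPath Λ) (m p q : Fin k → ℕ) :
    shift x m (p, q) = x (m + p, m + q) := rfl

theorem shift_zero {k : ℕ} {Λ : KGraph.{u} k} (x : PartialPath Λ) : shift x 0 = x := by
  funext pq
  simp [shift]

theorem shift_shift {k : ℕ} {Λ : KGraph.{u} k} (x : PartialPath Λ) (m n : Fin k → ℕ) :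
    shift (shift x m) n = shift x (m + n) := by
  funext pq
  simp [shift, add_assoc]

namespace IsPath

variable {k : ℕ} {Λ : KGraph.{u} k} {x y : PartialPath Λ} {m m' : Fin k → ℕ∞}

theorem le_of_mem (hx : IsPath Λ x m) {p q a} (ha : a ∈ x (p, q)) : p ≤ q :=
  ((hx.dom_iff p q).1 (Part.dom_iff_mem.2 ⟨a, ha⟩)).1

theorem leDeg_of_mem (hx : IsPath Λ x m) {p q a} (ha : a ∈ x (p, q)) : LeDeg q m :=
  ((hx.dom_iff p q).1 (Part.dom_iff_mem.2 ⟨a, ha⟩)).2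

theorem exists_mem (hx : IsPath Λ x m) {p q : Fin k → ℕ} (h : p ≤ q) (hq : LeDeg q m) :
    ∃ a, a ∈ x (p, q) :=
  Part.dom_iff_mem.1 ((hx.dom_iff p q).2 ⟨h, hq⟩)

theorem zero_dom_iff (hx : IsPath Λ x m) (q : Fin k → ℕ) : (x (0, q)).Dom ↔ LeDeg q m := by
  rw [hx.dom_iff]
  exact and_iff_right (zero_le)

theorem d_eq_of_zero_mem (hx : IsPath Λ x m) {q a} (ha : a ∈ x (0, q)) : Λ.d a = q := by
  rw [hx.d_eq ha, tsub_zero]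

/-- The values of x on either side of p + d(a) compose to the same morphism, so unique factorisation
identifies them with a and b. -/
theorem factor_mem (hx : IsPath Λ x m) {p q : Fin k → ℕ} {a b : Λ.Mor} {h : Λ.s a = Λ.r b}
    (hab : Λ.comp a b h ∈ x (p, q)) : a ∈ x (p, p + Λ.d a) ∧ b ∈ x (p + Λ.d a, q) := by
  have hd := hx.d_eq hab
  have hle := hx.le_of_mem hab
  rw [Λ.d_comp] at hd
  have h1 : p + Λ.d a ≤ q := by
    rw [← add_tsub_cancel_of_le hle, ← hd]
    gcongr
    exact le_self_add
  obtain ⟨a', ha'⟩ := hx.exists_mem (p := p) le_self_add ((hx.leDeg_of_mem hab).mono h1)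
  obtain ⟨b', hb'⟩ := hx.exists_mem h1 (hx.leDeg_of_mem hab)
  obtain ⟨h', hc⟩ := hx.comp_mem ha' hb'
  obtain ⟨rfl, rfl⟩ := Λ.comp_inj h h' (Part.mem_unique hab hc)
    (by rw [hx.d_eq ha', add_tsub_cancel_left])
  exact ⟨ha', hb'⟩

theorem exists_comp (hx : IsPath Λ x m) {p q t : Fin k → ℕ} {a : Λ.Mor} (ha : a ∈ x (p, q))
    (h : q ≤ t) (ht : LeDeg t m) :
    ∃ b, b ∈ x (q, t) ∧ ∃ h : Λ.s a = Λ.r b, Λ.comp a b h ∈ x (p, t) := by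
  obtain ⟨b, hb⟩ := hx.exists_mem h ht
  exact ⟨b, hb, hx.comp_mem ha hb⟩

/-- A path is determined by its initial segments. -/
theorem le_of_initial (hx : IsPath Λ x m) (hy : IsPath Λ y m')
    (h : ∀ q a, a ∈ x (0, q) → a ∈ y (0, q)) {p q a} (ha : a ∈ x (p, q)) : a ∈ y (p, q) := by
  have hq := hx.leDeg_of_mem ha
  have hpq := hx.le_of_mem ha
  -- With b = x(0, p), the composite ba = x(0, q) is an initial segment of y, and factoring it there
  -- recovers a.
  obtain ⟨b, hb⟩ := hx.exists_mem (zero_le (a := p)) (hq.mono hpq)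
  obtain ⟨hc, hba⟩ := hx.comp_mem hb ha
  simpa [hx.d_eq_of_zero_mem hb] using (hy.factor_mem (h _ _ hba)).2

theorem ext (hx : IsPath Λ x m) (hy : IsPath Λ y m')
    (h : ∀ q, x (0, q) = y (0, q)) : x = y := by
  funext ⟨p, q⟩
  refine Part.ext fun a => ⟨hx.le_of_initial hy (fun q a ha => h q ▸ ha),
    hy.le_of_initial hx (fun q a ha => (h q).symm ▸ ha)⟩

theorem shift (hx : IsPath Λ x m) {p : Fin k → ℕ} (hp : LeDeg p m) :
    IsPath Λ (shift x p) (fun i => m i - (p i : ℕ∞)) where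
  dom_iff a b := by
    rw [shift_apply, hx.dom_iff, leDeg_add_iff, and_iff_right hp, add_le_add_iff_left]
  r_mem ha := hx.r_mem ha
  s_mem ha := hx.s_mem ha
  comp_mem ha hb := hx.comp_mem ha hb
  d_eq ha := by
    rw [hx.d_eq ha]
    exact add_tsub_add_eq_tsub_left _ _ _

/-- The domain determines the set of q ≤ m, and testing it on multiples of the unit vectors recovers
each coordinate of m, finite or not. -/
theorem degree_unique (hx : IsPath Λ x m) (hx' : IsPath Λ x m') : m = m' := by
  have h : ∀ q, LeDeg q m ↔ LeDeg q m' := fun q => by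
    rw [← hx.zero_dom_iff, hx'.zero_dom_iff]
  have key : ∀ {m m' : Fin k → ℕ∞}, (∀ q, LeDeg q m → LeDeg q m') → ∀ i, m i ≤ m' i := by
    intro m m' h i
    refine ENat.forall_natCast_le_iff_le.1 fun n hn => ?_
    have h1 := h (Pi.single i n) (fun j => by
      by_cases hj : j = i
      · subst hj; simpa using hn
      · simp [hj]) i
    simpa using h1
  exact funext fun i => le_antisymm (key (fun q => (h q).1) i) (key (fun q => (h q).2) i)

/-- A path is determined by an initial segment and the rest. -/
theorem eq_of_shift_eq (hx : IsPath Λ x m) (hy : IsPath Λ y m') {p : Fin k → ℕ} {a : Λ.Mor}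
    (hax : a ∈ x (0, p)) (hay : a ∈ y (0, p)) (h : _root_.shift x p = _root_.shift y p) :
    x = y := by
  have key : ∀ {x y : PartialPath Λ} {m m'}, IsPath Λ x m → IsPath Λ y m' → a ∈ x (0, p) →
      a ∈ y (0, p) → _root_.shift x p = _root_.shift y p → ∀ q b, b ∈ x (0, q) → b ∈ y (0, q) := by
    intro x y m m' hx hy hax hay h q b hb
    -- Both a and b are initial segments of x(0, p ∨ q) = ac. The factor c is read off the common
    -- shift, so ac is a segment of y, and hence so is b.
    obtain ⟨c, hc, hs, hac⟩ := hx.exists_comp hax le_sup_left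
      ((hx.leDeg_of_mem hax).sup (hx.leDeg_of_mem hb))
    obtain ⟨e, he, hs', hbe⟩ := hx.exists_comp hb le_sup_right
      ((hx.leDeg_of_mem hax).sup (hx.leDeg_of_mem hb))
    have hcy : c ∈ y (p, p ⊔ q) := by
      have h1 := congrFun h (0, p ⊔ q - p)
      rw [shift_apply, shift_apply, add_zero, add_tsub_cancel_of_le le_sup_left] at h1
      rwa [← h1]
    obtain ⟨hs₁, hac'⟩ := hy.comp_mem hay hcy
    have hac'' : Λ.comp b e hs' ∈ y (0, p ⊔ q) := Part.mem_unique hac hbe ▸ hac'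
    simpa [hx.d_eq_of_zero_mem hb] using (hy.factor_mem hac'').1
  exact hx.ext hy fun q => Part.ext fun b =>
    ⟨key hx hy hax hay h q b, key hy hx hay hax h.symm q b⟩

end IsPath

/-! ### The shift actions -/

section Actions

variable {k : ℕ} {Λ : KGraph.{u} k}

theorem mem_actM {x z : PartialPath Λ} {m : Fin k → ℕ} :
    z ∈ (actM Λ).act (x, m) ↔ x ∈ PSm Λ ∧ (x (0, m)).Dom ∧ z = shift x m := by
  constructor
  · rintro ⟨⟨h1, h2⟩, rfl⟩
    exact ⟨h1, h2, rfl⟩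
  · rintro ⟨h1, h2, rfl⟩
    exact ⟨⟨h1, h2⟩, rfl⟩

theorem shift_mem_PSm {x : PartialPath Λ} (hx : x ∈ PSm Λ) {m : Fin k → ℕ}
    (h : (x (0, m)).Dom) : shift x m ∈ PSm Λ := by
  obtain ⟨d, hd⟩ := mem_PSm_iff.1 hx
  exact mem_PSm_iff.2 ⟨_, hd.shift ((hd.zero_dom_iff m).1 h)⟩

theorem dom_add_iff {x : PartialPath Λ} (hx : x ∈ PSm Λ) {m n : Fin k → ℕ} :
    (x (0, m + n)).Dom ↔ (x (0, m)).Dom ∧ (shift x m (0, n)).Dom := by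
  obtain ⟨d, hd⟩ := mem_PSm_iff.1 hx
  rw [shift_apply, hd.zero_dom_iff, hd.zero_dom_iff, hd.dom_iff, add_zero,
    and_iff_right le_self_add]
  exact ⟨fun h => ⟨h.mono le_self_add, h⟩, fun h => h.2⟩

theorem actM_isSemigroupAction : IsSemigroupAction (actM Λ) where
  mem_of_dom _ _ h := h.1
  mem_of_act x m y hy := by
    obtain ⟨h1, h2, rfl⟩ := mem_actM.1 hy
    exact shift_mem_PSm h1 h2
  act_zero x hx := by
    obtain ⟨d, hd⟩ := mem_PSm_iff.1 hx
    exact mem_actM.2 ⟨hx, (hd.zero_dom_iff 0).2 fun i => by simp, (shift_zero x).symm⟩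
  dom_add x hx m n := by
    constructor
    · rintro ⟨-, h⟩
      have h' := (dom_add_iff hx).1 h
      exact ⟨shift x m, mem_actM.2 ⟨hx, h'.1, rfl⟩, shift_mem_PSm hx h'.1, h'.2⟩
    · rintro ⟨y, hy, -, h⟩
      obtain ⟨-, h2, rfl⟩ := mem_actM.1 hy
      exact ⟨hx, (dom_add_iff hx).2 ⟨h2, h⟩⟩
  act_add x hx m n y hy z hz := by
    obtain ⟨-, h2, rfl⟩ := mem_actM.1 hy
    obtain ⟨-, h3, rfl⟩ := mem_actM.1 hz
    exact mem_actM.2 ⟨hx, (dom_add_iff hx).2 ⟨h2, h3⟩, shift_shift x m n⟩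

/-- Yeend's conditions prescribe the degree and all initial segments of y, which leaves only the
shift. Uniqueness of degrees identifies the existential m in the definition with the given one. -/
theorem isYeeShift_iff {x y : PartialPath Λ} {m : Fin k → ℕ∞} {p : Fin k → ℕ}
    (hx : HasDegree Λ x m) (hp : LeDeg p m) : IsYeeShift Λ p x y ↔ y = shift x p := by
  have hx := hasDegree_iff_isPath.1 hx
  constructor
  · rintro ⟨m', hx', hp', hy, h⟩
    obtain rfl := hx.degree_unique (hasDegree_iff_isPath.1 hx')
    rw [hasDegree_iff_isPath] at hy
    have hsh := hx.shift hp
    refine hy.ext hsh fun q => ?_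
    by_cases hq : LeDeg q (fun i => m i - (p i : ℕ∞))
    · rw [h q hq, shift_apply, add_zero]
    · rw [Part.eq_none_iff'.2 (mt (hy.zero_dom_iff q).1 hq),
        Part.eq_none_iff'.2 (mt (hsh.zero_dom_iff q).1 hq)]
  · rintro rfl
    refine ⟨m, hasDegree_iff_isPath.2 hx, hp, hasDegree_iff_isPath.2 (hx.shift hp),
      fun q _ => ?_⟩
    rw [shift_apply, add_zero]

theorem existsUnique_isYeeShift (x : PartialPath Λ) (m : Fin k → ℕ∞) (p : Fin k → ℕ)
    (hx : HasDegree Λ x m) (hp : LeDeg p m) : ∃! y, IsYeeShift Λ p x y :=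
  ⟨shift x p, (isYeeShift_iff hx hp).2 rfl, fun _ h => (isYeeShift_iff hx hp).1 h⟩

/-- Wherever `actYee` is defined exactly one path satisfies `IsYeeShift`, so the choice made by
`Classical.epsilon` is the shift. -/
theorem actM_eq_actYee : actM Λ = actYee Λ := by
  have h : (actM Λ).act = (actYee Λ).act := by
    funext ⟨x, p⟩
    refine Part.ext' ?_ ?_
    · change x ∈ PSm Λ ∧ (x (0, p)).Dom ↔ ∃ m, HasDegree Λ x m ∧ LeDeg p m
      rw [mem_PSm_iff]
      constructor
      · rintro ⟨⟨m, hm⟩, h⟩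
        exact ⟨m, hasDegree_iff_isPath.2 hm, (hm.zero_dom_iff p).1 h⟩
      · rintro ⟨m, hm, h⟩
        have hm := hasDegree_iff_isPath.1 hm
        exact ⟨⟨m, hm⟩, (hm.zero_dom_iff p).2 h⟩
    · rintro - ⟨m, hm, h⟩
      exact ((isYeeShift_iff hm h).1
        (Classical.epsilon_spec (existsUnique_isYeeShift x m p hm h).exists)).symm
  have h' : (actM Λ).carrier = (actYee Λ).carrier := PSm_eq_PSYee Λ
  exact (PartialAction.mk.injEq ..).mpr ⟨h', h⟩

/-- Prefixing by a is undone by shifting by d(a). This turns y = ax into a condition on y alone, so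
that Z(F, n) can be described without concatenation. -/
theorem isYeeConcat_iff {a : Λ.Mor} {x y : PartialPath Λ} :
    IsYeeConcat Λ a x y ↔ y ∈ PSm Λ ∧ a ∈ y (0, Λ.d a) ∧ x = shift y (Λ.d a) := by
  constructor
  · rintro ⟨m, hx, hs, hy, ha, h⟩
    have hx' := hasDegree_iff_isPath.1 hx
    have hy' := hasDegree_iff_isPath.1 hy
    have hsh := hy'.shift (hy'.leDeg_of_mem ha)
    refine ⟨mem_PSm_iff.2 ⟨_, hy'⟩, ha, hx'.ext hsh fun q => ?_⟩
    by_cases hq : LeDeg q m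
    · rw [← h q hq, shift_apply, add_zero]
    -- For q not below m both values are undefined: the shift of y has degree (d(a) + m) - d(a),
    -- which is at most m.
    · refine (Part.eq_none_iff'.2 (mt (hx'.zero_dom_iff q).1 hq)).trans
        (Part.eq_none_iff'.2 fun h0 => ?_).symm
      have h1 := (hsh.zero_dom_iff q).1 h0
      refine hq fun i => (h1 i).trans ?_
      exact tsub_le_iff_left.2 le_rfl
  · rintro ⟨hy, ha, rfl⟩
    obtain ⟨m, hy⟩ := mem_PSm_iff.1 hy
    have hm := hy.leDeg_of_mem ha
    refine ⟨_, hasDegree_iff_isPath.2 (hy.shift hm), ?_, ?_, ha, ?_⟩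
    · simpa [shift_apply] using hy.s_mem ha
    · have : (fun i => (Λ.d a i : ℕ∞) + (m i - (Λ.d a i : ℕ∞))) = m :=
        funext fun i => add_tsub_cancel_of_le (hm i)
      rw [this]
      exact hasDegree_iff_isPath.2 hy
    · intro p _
      rw [shift_apply, add_zero]

end Actions

/-! ### Coterminal pairs -/

section Differences

variable {k : ℕ} {m n m' n' : Fin k → ℕ}

theorem degDiff_eq_iff : degDiff m n = degDiff m' n' ↔ m + n' = m' + n := by
  simp only [funext_iff, degDiff, Pi.add_apply]
  exact forall_congr' fun i => by omega

theorem degDiff_add_add (m n e : Fin k → ℕ) : degDiff (m + e) (n + e) = degDiff m n := by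
  rw [degDiff_eq_iff]
  abel

theorem degDiff_add_degDiff (m n p : Fin k → ℕ) :
    degDiff m n + degDiff n p = degDiff m p := by
  funext i
  simp [degDiff]

theorem neg_degDiff (m n : Fin k → ℕ) : -degDiff m n = degDiff n m := by
  funext i
  simp [degDiff]

end Differences

/-- The paths `x` and `y` are of the form `az` and `bz` for a common path `z`. -/
structure Coterminal {k : ℕ} {Λ : KGraph.{u} k} (a b : Λ.Mor) (x y : PartialPath Λ) : Prop where
  left_mem : x ∈ PSm Λ
  right_mem : y ∈ PSm Λ
  left : a ∈ x (0, Λ.d a)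
  right : b ∈ y (0, Λ.d b)
  shift_eq : shift x (Λ.d a) = shift y (Λ.d b)

/-! ### Initial segments of paths -/

section PathsInPSm

variable {k : ℕ} {Λ : KGraph.{u} k} {x y : PartialPath Λ}

theorem zero_dom_sup (hx : x ∈ PSm Λ) {m n : Fin k → ℕ} (hm : (x (0, m)).Dom)
    (hn : (x (0, n)).Dom) : (x (0, m ⊔ n)).Dom := by
  obtain ⟨d, hd⟩ := mem_PSm_iff.1 hx
  rw [hd.zero_dom_iff] at hm hn ⊢
  exact hm.sup hn

theorem exists_mem_zero (hx : x ∈ PSm Λ) {m : Fin k → ℕ} (hm : (x (0, m)).Dom) :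
    ∃ a, Λ.d a = m ∧ a ∈ x (0, m) := by
  obtain ⟨d, hd⟩ := mem_PSm_iff.1 hx
  obtain ⟨a, ha⟩ := Part.dom_iff_mem.1 hm
  exact ⟨a, hd.d_eq_of_zero_mem ha, ha⟩

theorem dom_of_mem_zero {a : Λ.Mor} {m : Fin k → ℕ} (h : a ∈ x (0, m)) : (x (0, m)).Dom :=
  Part.dom_iff_mem.2 ⟨a, h⟩

theorem mem_initialSegments_iff (hx : x ∈ PSm Λ) {a : Λ.Mor} :
    a ∈ initialSegments Λ x ↔ a ∈ x (0, Λ.d a) := by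
  obtain ⟨d, hd⟩ := mem_PSm_iff.1 hx
  constructor
  · rintro ⟨q, hq⟩
    rwa [hd.d_eq_of_zero_mem hq]
  · exact fun h => ⟨_, h⟩

theorem factor_mem_zero (hx : x ∈ PSm Λ) {a b : Λ.Mor} {h : Λ.s a = Λ.r b}
    (hab : Λ.comp a b h ∈ x (0, Λ.d (Λ.comp a b h))) :
    a ∈ x (0, Λ.d a) ∧ b ∈ x (Λ.d a, Λ.d a + Λ.d b) := by
  obtain ⟨d, hd⟩ := mem_PSm_iff.1 hx
  have := hd.factor_mem hab
  rwa [zero_add, Λ.d_comp] at this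

theorem comp_mem_zero (hx : x ∈ PSm Λ) {a b : Λ.Mor} (ha : a ∈ x (0, Λ.d a))
    (hb : b ∈ x (Λ.d a, Λ.d a + Λ.d b)) :
    ∃ h : Λ.s a = Λ.r b, Λ.comp a b h ∈ x (0, Λ.d (Λ.comp a b h)) := by
  obtain ⟨d, hd⟩ := mem_PSm_iff.1 hx
  obtain ⟨h, hc⟩ := hd.comp_mem ha hb
  exact ⟨h, by rwa [Λ.d_comp]⟩

theorem mem_extensions_of_mem (hx : x ∈ PSm Λ) {a c : Λ.Mor} (ha : a ∈ x (0, Λ.d a))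
    (hc : c ∈ x (0, Λ.d c)) (h : Λ.d a ≤ Λ.d c) : c ∈ Λ.extensions a := by
  obtain ⟨d, hd⟩ := mem_PSm_iff.1 hx
  obtain ⟨b, -, hs, hab⟩ := hd.exists_comp ha h (hd.leDeg_of_mem hc)
  exact ⟨b, hs, Part.mem_unique hab hc⟩

theorem mem_of_mem_extensions (hx : x ∈ PSm Λ) {a c : Λ.Mor} (hc : c ∈ x (0, Λ.d c))
    (h : c ∈ Λ.extensions a) : a ∈ x (0, Λ.d a) := by
  obtain ⟨b, h, rfl⟩ := h
  exact (factor_mem_zero hx hc).1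

theorem s_mem_shift (hx : x ∈ PSm Λ) {a : Λ.Mor} (ha : a ∈ x (0, Λ.d a)) :
    Λ.s a ∈ shift x (Λ.d a) (0, 0) := by
  obtain ⟨d, hd⟩ := mem_PSm_iff.1 hx
  simpa [shift_apply] using hd.s_mem ha

end PathsInPSm

namespace Coterminal

variable {k : ℕ} {Λ : KGraph.{u} k} {x y z x' y' : PartialPath Λ} {a b c a' b' : Λ.Mor}

theorem symm (h : Coterminal a b x y) : Coterminal b a y x :=
  ⟨h.right_mem, h.left_mem, h.right, h.left, h.shift_eq.symm⟩

theorem trans (h : Coterminal a b x y) (h' : Coterminal b c y z) : Coterminal a c x z :=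
  ⟨h.left_mem, h'.right_mem, h.left, h'.right, h.shift_eq.trans h'.shift_eq⟩

/-- Both sources are the vertex at which the common shifted path begins. -/
theorem source_eq (h : Coterminal a b x y) : Λ.s a = Λ.s b := by
  have h1 := s_mem_shift h.left_mem h.left
  rw [h.shift_eq] at h1
  exact Part.mem_unique h1 (s_mem_shift h.right_mem h.right)

theorem apply_eq (h : Coterminal a b x y) (e : Fin k → ℕ) :
    x (Λ.d a, Λ.d a + e) = y (Λ.d b, Λ.d b + e) := by
  have := congrFun h.shift_eq (0, e)
  rwa [shift_apply, shift_apply, add_zero, add_zero] at this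

/-- If `x = az`, `y = bz` and `x` begins with `ac`, then `x = acw` and `y = bcw`. -/
theorem comp_right (h : Coterminal a b x y) {hac : Λ.s a = Λ.r c}
    (hc : Λ.comp a c hac ∈ x (0, Λ.d (Λ.comp a c hac))) :
    Coterminal (Λ.comp a c hac) (Λ.comp b c (h.source_eq.symm.trans hac)) x y := by
  have h1 := (factor_mem_zero h.left_mem hc).2
  rw [h.apply_eq] at h1
  obtain ⟨hbc, h2⟩ := comp_mem_zero h.right_mem h.right h1
  refine ⟨h.left_mem, h.right_mem, hc, h2, ?_⟩
  rw [Λ.d_comp, Λ.d_comp, ← shift_shift, ← shift_shift, h.shift_eq]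

/-- The shifts of x past a and of y past b both begin with c and agree after it, so they are equal.
-/
theorem of_comp {hac : Λ.s a = Λ.r c} {hbc : Λ.s b = Λ.r c}
    (h : Coterminal (Λ.comp a c hac) (Λ.comp b c hbc) x y) : Coterminal a b x y := by
  obtain ⟨h1, h2⟩ := factor_mem_zero h.left_mem h.left
  obtain ⟨h3, h4⟩ := factor_mem_zero h.right_mem h.right
  refine ⟨h.left_mem, h.right_mem, h1, h3, ?_⟩
  obtain ⟨m, hx⟩ := mem_PSm_iff.1 (shift_mem_PSm h.left_mem (dom_of_mem_zero h1))
  obtain ⟨n, hy⟩ := mem_PSm_iff.1 (shift_mem_PSm h.right_mem (dom_of_mem_zero h3))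
  refine hx.eq_of_shift_eq hy (p := Λ.d c) (a := c) ?_ ?_ ?_
  · rwa [shift_apply, add_zero]
  · rwa [shift_apply, add_zero]
  · rw [shift_shift, shift_shift, ← Λ.d_comp a c hac, ← Λ.d_comp b c hbc, h.shift_eq]

theorem exists_comp (h : Coterminal a b x y) {e : Fin k → ℕ} (he : (x (0, Λ.d a + e)).Dom) :
    ∃ c, ∃ (hac : Λ.s a = Λ.r c) (hbc : Λ.s b = Λ.r c), Λ.d c = e ∧
      Coterminal (Λ.comp a c hac) (Λ.comp b c hbc) x y := by
  obtain ⟨a', hd, ha'⟩ := exists_mem_zero h.left_mem he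
  rw [← hd] at ha'
  obtain ⟨c, hac, rfl⟩ := mem_extensions_of_mem h.left_mem h.left ha' (hd ▸ le_self_add)
  rw [Λ.d_comp] at hd
  exact ⟨c, hac, _, add_left_cancel hd, h.comp_right ha'⟩

/-- Write a' = ac. Equal degree differences force d(b') = d(b) + d(c), and y has only one initial
segment of that degree, namely bc. -/
theorem exists_eq_comp (h : Coterminal a b x y) (h' : Coterminal a' b' x y)
    (hd : degDiff (Λ.d a) (Λ.d b) = degDiff (Λ.d a') (Λ.d b')) (hle : Λ.d a ≤ Λ.d a') :
    ∃ c, ∃ (hac : Λ.s a = Λ.r c) (hbc : Λ.s b = Λ.r c),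
      a' = Λ.comp a c hac ∧ b' = Λ.comp b c hbc := by
  obtain ⟨c, hac, rfl⟩ := mem_extensions_of_mem h.left_mem h.left h'.left hle
  have h1 := h.comp_right h'.left
  have h2 := h'.right
  rw [degDiff_eq_iff, Λ.d_comp, add_assoc, add_left_cancel_iff, add_comm] at hd
  have h3 := h1.right
  rw [Λ.d_comp, ← hd] at h3
  exact ⟨c, hac, _, rfl, Part.mem_unique h2 h3⟩

/-- Coterminality along shorter segments is inherited by all paths that are coterminal along the
same longer segments. -/
theorem of_le (h : Coterminal a b x y) (h' : Coterminal a' b' x y)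
    (hd : degDiff (Λ.d a) (Λ.d b) = degDiff (Λ.d a') (Λ.d b')) (hle : Λ.d a ≤ Λ.d a')
    (hx : Coterminal a' b' x' y') : Coterminal a b x' y' := by
  obtain ⟨c, hac, hbc, rfl, rfl⟩ := h.exists_eq_comp h' hd hle
  exact hx.of_comp

/-- The pair is lengthened to first degree d(a) ∨ d(a'), which stays inside the domain of x. This
makes it comparable with any prescribed segment of x. -/
theorem exists_common (h : Coterminal a b x y) (hd : (x (0, Λ.d a')).Dom) :
    ∃ c, ∃ (hac : Λ.s a = Λ.r c) (hbc : Λ.s b = Λ.r c),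
      Λ.d a' ≤ Λ.d (Λ.comp a c hac) ∧ Coterminal (Λ.comp a c hac) (Λ.comp b c hbc) x y := by
  have h1 : Λ.d a ⊔ Λ.d a' = Λ.d a + (Λ.d a ⊔ Λ.d a' - Λ.d a) :=
    (add_tsub_cancel_of_le le_sup_left).symm
  obtain ⟨c, hac, hbc, hc, h2⟩ :=
    h.exists_comp (h1 ▸ zero_dom_sup h.left_mem (dom_of_mem_zero h.left) hd)
  refine ⟨c, hac, hbc, ?_, h2⟩
  rw [Λ.d_comp, hc, ← h1]
  exact le_sup_right

theorem degDiff_comp {hac : Λ.s a = Λ.r c} {hbc : Λ.s b = Λ.r c} :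
    degDiff (Λ.d (Λ.comp a c hac)) (Λ.d (Λ.comp b c hbc)) = degDiff (Λ.d a) (Λ.d b) := by
  rw [Λ.d_comp, Λ.d_comp, degDiff_add_add]

/-- Coterminal pairs for `(x, y)` and `(y, z)` have refinements with the same middle segment. -/
theorem exists_middle {b₁ b₂ : Λ.Mor} (h : Coterminal a b₁ x y) (h' : Coterminal b₂ c y z) :
    ∃ a' b' c' : Λ.Mor, Coterminal a' b' x y ∧ Coterminal b' c' y z ∧
      degDiff (Λ.d a') (Λ.d b') = degDiff (Λ.d a) (Λ.d b₁) ∧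
      degDiff (Λ.d b') (Λ.d c') = degDiff (Λ.d b₂) (Λ.d c) := by
  -- The first pair is lengthened until its middle segment reaches degree at least d(b₂). That
  -- segment then has the form b₂f, and the second pair is lengthened by f.
  obtain ⟨e, h1, h2, h3, h4⟩ := h.symm.exists_common (a' := b₂) (dom_of_mem_zero h'.left)
  obtain ⟨f, h5, h6⟩ := mem_extensions_of_mem h.right_mem h'.left h4.left h3
  have h7 := h4.left
  rw [← h6] at h7
  refine ⟨_, _, Λ.comp c f (h'.source_eq.symm.trans h5), h4.symm, ?_, degDiff_comp, ?_⟩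
  · rw [← h6]
    exact h'.comp_right h7
  · rw [← h6]
    exact degDiff_comp

end Coterminal

theorem exists_coterminal {k : ℕ} {Λ : KGraph.{u} k} {x y : PartialPath Λ} {m n : Fin k → ℕ} :
    (x ∈ PSm Λ ∧ y ∈ PSm Λ ∧ ∃ z, z ∈ (actM Λ).act (x, m) ∧ z ∈ (actM Λ).act (y, n)) ↔
      ∃ a b : Λ.Mor, Λ.d a = m ∧ Λ.d b = n ∧ Coterminal a b x y := by
  constructor
  · rintro ⟨hx, hy, z, h1, h2⟩
    obtain ⟨-, h3, rfl⟩ := mem_actM.1 h1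
    obtain ⟨-, h4, h5⟩ := mem_actM.1 h2
    obtain ⟨a, rfl, ha⟩ := exists_mem_zero hx h3
    obtain ⟨b, rfl, hb⟩ := exists_mem_zero hy h4
    exact ⟨a, b, rfl, rfl, hx, hy, ha, hb, h5⟩
  · rintro ⟨a, b, rfl, rfl, h⟩
    exact ⟨h.left_mem, h.right_mem, _,
      mem_actM.2 ⟨h.left_mem, dom_of_mem_zero h.left, rfl⟩,
      mem_actM.2 ⟨h.right_mem, dom_of_mem_zero h.right, h.shift_eq⟩⟩

theorem mem_actionTriples_iff {k : ℕ} {Λ : KGraph.{u} k} {x y : PartialPath Λ}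
    {q : Fin k → ℤ} : (x, q, y) ∈ actionTriples (actM Λ) ↔
      ∃ a b : Λ.Mor, q = degDiff (Λ.d a) (Λ.d b) ∧ Coterminal a b x y := by
  constructor
  · rintro ⟨hx, hy, m, n, hq, hz⟩
    obtain ⟨a, b, rfl, rfl, h⟩ := exists_coterminal.1 ⟨hx, hy, hz⟩
    exact ⟨a, b, hq, h⟩
  · rintro ⟨a, b, hq, h⟩
    have := exists_coterminal.2 ⟨a, b, rfl, rfl, h⟩
    exact ⟨this.1, this.2.1, _, _, hq, this.2.2⟩

/-! ### The topology of the path groupoid -/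

section Topologies

variable {k : ℕ} (Λ : KGraph.{u} k)

/-- The paths that begin with `a`. -/
def startsWith (a : Λ.Mor) : Set (PSm Λ) :=
  {x | a ∈ initialSegments Λ x.1}

theorem isOpen_startsWith (a : Λ.Mor) : IsOpen[topPSm Λ] (startsWith Λ a) := by
  refine TopologicalSpace.isOpen_generateFrom_of_mem
    ⟨{a}, ∅, Set.finite_singleton a, Set.finite_empty, ?_⟩
  ext x
  change _ ↔ _ ∧ _
  simp [startsWith]

theorem isOpen_compl_startsWith (a : Λ.Mor) : IsOpen[topPSm Λ] (startsWith Λ a)ᶜ := by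
  refine TopologicalSpace.isOpen_generateFrom_of_mem
    ⟨∅, {a}, Set.finite_empty, Set.finite_singleton a, ?_⟩
  ext x
  change _ ↔ _ ∧ _
  simp [startsWith]

theorem fellSet_eq (K₁ K₂ : Set Λ.Mor) :
    fellSet Λ K₁ K₂ = (⋂ a ∈ K₁, startsWith Λ a) ∩ ⋂ a ∈ K₂, (startsWith Λ a)ᶜ := by
  ext x
  simp only [fellSet, startsWith, Set.mem_inter_iff, Set.mem_iInter, Set.mem_compl_iff]
  exact and_congr Iff.rfl
    ⟨fun h a ha ha' => h ha' ha, fun h a ha ha' => h a ha' ha⟩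

/-- Continuity of a map into the path space can be checked on the sets of paths with a given
initial segment. -/
theorem continuous_of_startsWith {X : Type*} [TopologicalSpace X] {f : X → PSm Λ}
    (h : ∀ a, IsClopen (f ⁻¹' startsWith Λ a)) : Continuous[_, topPSm Λ] f := by
  refine continuous_generateFrom_iff.2 ?_
  rintro _ ⟨K₁, K₂, h₁, h₂, rfl⟩
  rw [fellSet_eq, Set.preimage_inter, Set.preimage_iInter₂, Set.preimage_iInter₂]
  exact (h₁.isOpen_biInter fun a _ => (h a).isOpen).inter
    (h₂.isOpen_biInter fun a _ => (h a).compl.isOpen)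

/-- The set of all `(az, d(a) - d(b), bz)`. -/
def coterminalSet (a b : Λ.Mor) : Set (actionTriples (actM Λ)) :=
  {g | g.1.2.1 = degDiff (Λ.d a) (Λ.d b) ∧ Coterminal a b g.1.1 g.1.2.2}

variable {Λ}

def rangePath (g : actionTriples (actM Λ)) : PSm Λ := ⟨g.1.1, g.2.1⟩

def sourcePath (g : actionTriples (actM Λ)) : PSm Λ := ⟨g.1.2.2, g.2.2.1⟩

theorem mem_startsWith {x : PSm Λ} {a : Λ.Mor} :
    x ∈ startsWith Λ a ↔ a ∈ x.1 (0, Λ.d a) :=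
  mem_initialSegments_iff x.2

theorem exists_mem_coterminalSet (g : actionTriples (actM Λ)) :
    ∃ a b, g ∈ coterminalSet Λ a b :=
  mem_actionTriples_iff.1 g.2

theorem mem_cylinders_iff {W : Set (actionTriples (actM Λ))} :
    W ∈ cylinders (actM Λ) (topPSm Λ) ↔ ∃ (U V : Set (PSm Λ)) (m n : Fin k → ℕ),
      IsOpen[topPSm Λ] U ∧ IsOpen[topPSm Λ] V ∧ W = cylinder (actM Λ) U m n V :=
  Iff.rfl

theorem mem_cylinder_iff {g : actionTriples (actM Λ)} {U V : Set (PSm Λ)}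
    {m n : Fin k → ℕ} : g ∈ cylinder (actM Λ) U m n V ↔ rangePath g ∈ U ∧ sourcePath g ∈ V ∧
      ∃ a b, Λ.d a = m ∧ Λ.d b = n ∧ g ∈ coterminalSet Λ a b := by
  constructor
  · rintro ⟨h1, ⟨x, hx, hxg⟩, ⟨y, hy, hyg⟩, hz⟩
    obtain ⟨a, b, rfl, rfl, h⟩ := exists_coterminal.1 ⟨g.2.1, g.2.2.1, hz⟩
    obtain rfl : x = rangePath g := Subtype.ext hxg
    obtain rfl : y = sourcePath g := Subtype.ext hyg
    exact ⟨hx, hy, a, b, rfl, rfl, h1, h⟩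
  · rintro ⟨hx, hy, a, b, rfl, rfl, h1, h⟩
    exact ⟨h1, ⟨_, hx, rfl⟩, ⟨_, hy, rfl⟩, (exists_coterminal.2 ⟨a, b, rfl, rfl, h⟩).2.2⟩

theorem mem_cylinder_of_mem {g : actionTriples (actM Λ)} {U V : Set (PSm Λ)}
    {a b : Λ.Mor} (hU : rangePath g ∈ U) (hV : sourcePath g ∈ V) (h : g ∈ coterminalSet Λ a b) :
    g ∈ cylinder (actM Λ) U (Λ.d a) (Λ.d b) V :=
  mem_cylinder_iff.2 ⟨hU, hV, a, b, rfl, rfl, h⟩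

/-- A path has one initial segment of each degree, so prescribing the beginnings a and b pins down
the segments hidden in the equation x · d(a) = y · d(b). -/
theorem coterminalSet_eq_cylinder (a b : Λ.Mor) :
    coterminalSet Λ a b =
      cylinder (actM Λ) (startsWith Λ a) (Λ.d a) (Λ.d b) (startsWith Λ b) := by
  ext g
  constructor
  · intro h
    exact mem_cylinder_of_mem (mem_startsWith.2 h.2.left) (mem_startsWith.2 h.2.right) h
  · intro h
    obtain ⟨h1, h2, a', b', ha, hb, h3, h4⟩ := mem_cylinder_iff.1 h
    have h1 : a ∈ g.1.1 (0, Λ.d a) := mem_startsWith.1 h1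
    have h2 : b ∈ g.1.2.2 (0, Λ.d b) := mem_startsWith.1 h2
    obtain rfl := Part.mem_unique h1 (ha ▸ h4.left)
    obtain rfl := Part.mem_unique h2 (hb ▸ h4.right)
    exact ⟨h3, h4⟩

/-- The shared point g forces equal degree differences and makes (a', b') a common lengthening (ac,
bc) of (a, b). Every pair of paths coterminal along (ac, bc) is coterminal along (a, b). -/
theorem coterminalSet_subset {g : actionTriples (actM Λ)} {a b a' b' : Λ.Mor}
    (h : g ∈ coterminalSet Λ a b) (h' : g ∈ coterminalSet Λ a' b') (hle : Λ.d a ≤ Λ.d a') :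
    coterminalSet Λ a' b' ⊆ coterminalSet Λ a b := by
  have hd := h.1.symm.trans h'.1
  exact fun g' hg' => ⟨hg'.1.trans hd.symm, h.2.of_le h'.2 hd hle hg'.2⟩

theorem exists_mem_coterminalSet_of_le {g : actionTriples (actM Λ)} {a b : Λ.Mor}
    (h : g ∈ coterminalSet Λ a b) {c : Λ.Mor} (hc : c ∈ g.1.1 (0, Λ.d c)) :
    ∃ a' b', g ∈ coterminalSet Λ a' b' ∧ coterminalSet Λ a' b' ⊆ coterminalSet Λ a b ∧
      Λ.d c ≤ Λ.d a' := by
  obtain ⟨e, h1, h2, h3, h4⟩ := h.2.exists_common (dom_of_mem_zero hc)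
  have h5 : g ∈ coterminalSet Λ _ _ := ⟨h.1.trans Coterminal.degDiff_comp.symm, h4⟩
  exact ⟨_, _, h5, coterminalSet_subset h h5 (by rw [Λ.d_comp]; exact le_self_add), h3⟩

theorem exists_mem_coterminalSet_subset_inter {g : actionTriples (actM Λ)} {a b a' b' : Λ.Mor}
    (h : g ∈ coterminalSet Λ a b) (h' : g ∈ coterminalSet Λ a' b') :
    ∃ c e, g ∈ coterminalSet Λ c e ∧
      coterminalSet Λ c e ⊆ coterminalSet Λ a b ∩ coterminalSet Λ a' b' := by
  obtain ⟨c, e, h1, h2, h3⟩ := exists_mem_coterminalSet_of_le h h'.2.left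
  exact ⟨c, e, h1, Set.subset_inter h2 (coterminalSet_subset h' h1 h3)⟩

theorem isTopologicalBasis_cylinders :
    @TopologicalSpace.IsTopologicalBasis _
      (TopologicalSpace.generateFrom (cylinders (actM Λ) (topPSm Λ)))
      (cylinders (actM Λ) (topPSm Λ)) := by
  let _ := topPSm Λ
  let _ := TopologicalSpace.generateFrom (cylinders (actM Λ) (topPSm Λ))
  refine ⟨?_, ?_, rfl⟩
  · intro W hW W' hW' g hg
    obtain ⟨U, V, m, n, hU, hV, rfl⟩ := mem_cylinders_iff.1 hW
    obtain ⟨U', V', m', n', hU', hV', rfl⟩ := mem_cylinders_iff.1 hW'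
    obtain ⟨hg, hg'⟩ := hg
    obtain ⟨h1, h2, a, b, ha, hb, h⟩ := mem_cylinder_iff.1 hg
    obtain ⟨h1', h2', a', b', ha', hb', h'⟩ := mem_cylinder_iff.1 hg'
    obtain ⟨c, e, h3, h4⟩ := exists_mem_coterminalSet_subset_inter h h'
    -- Requiring the beginnings c and e confines the new cylinder to `coterminalSet Λ c e`, where
    -- both original coterminality conditions hold.
    refine ⟨_, mem_cylinders_iff.2 ⟨U ∩ U' ∩ startsWith Λ c, V ∩ V' ∩ startsWith Λ e,
      Λ.d c, Λ.d e, (hU.inter hU').inter (isOpen_startsWith Λ c),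
      (hV.inter hV').inter (isOpen_startsWith Λ e), rfl⟩,
      mem_cylinder_of_mem ⟨⟨h1, h1'⟩, mem_startsWith.2 h3.2.left⟩
        ⟨⟨h2, h2'⟩, mem_startsWith.2 h3.2.right⟩ h3, ?_⟩
    intro f hf
    obtain ⟨h5, h6, c', e', hc, he, h7⟩ := mem_cylinder_iff.1 hf
    have h8 : f ∈ coterminalSet Λ c e := by
      rw [coterminalSet_eq_cylinder]
      exact mem_cylinder_iff.2 ⟨h5.2, h6.2, c', e', hc, he, h7⟩
    exact ⟨mem_cylinder_iff.2 ⟨h5.1.1, h6.1.1, a, b, ha, hb, (h4 h8).1⟩,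
      mem_cylinder_iff.2 ⟨h5.1.2, h6.1.2, a', b', ha', hb', (h4 h8).2⟩⟩
  · refine Set.eq_univ_of_forall fun g => ?_
    obtain ⟨a, b, h⟩ := exists_mem_coterminalSet g
    exact Set.mem_sUnion.2 ⟨_, mem_cylinders_iff.2
      ⟨Set.univ, Set.univ, _, _, isOpen_univ, isOpen_univ, rfl⟩,
      mem_cylinder_of_mem trivial trivial h⟩

variable (Λ) in
/-- The topology of the path groupoid of graph morphisms. -/
@[reducible] def topPGm : TopologicalSpace (actionTriples (actM Λ)) :=
  TopologicalSpace.generateFrom (cylinders (actM Λ) (topPSm Λ))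

theorem isOpen_coterminalSet (a b : Λ.Mor) : IsOpen[topPGm Λ] (coterminalSet Λ a b) := by
  rw [coterminalSet_eq_cylinder]
  exact TopologicalSpace.isOpen_generateFrom_of_mem
    ⟨_, _, _, _, isOpen_startsWith Λ a, isOpen_startsWith Λ b, rfl⟩

theorem continuous_rangePath : Continuous[topPGm Λ, topPSm Λ] (rangePath (Λ := Λ)) := by
  let _ := topPSm Λ
  let _ := topPGm Λ
  refine continuous_def.2 fun U hU => isOpen_iff_forall_mem_open.2 fun g hg => ?_
  obtain ⟨a, b, h⟩ := exists_mem_coterminalSet g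
  exact ⟨_, fun f hf => (mem_cylinder_iff.1 hf).1,
    TopologicalSpace.isOpen_generateFrom_of_mem
      (mem_cylinders_iff.2 ⟨U, Set.univ, _, _, hU, isOpen_univ, rfl⟩),
    mem_cylinder_of_mem hg trivial h⟩

theorem continuous_sourcePath : Continuous[topPGm Λ, topPSm Λ] (sourcePath (Λ := Λ)) := by
  let _ := topPSm Λ
  let _ := topPGm Λ
  refine continuous_def.2 fun U hU => isOpen_iff_forall_mem_open.2 fun g hg => ?_
  obtain ⟨a, b, h⟩ := exists_mem_coterminalSet g
  exact ⟨_, fun f hf => (mem_cylinder_iff.1 hf).2.1,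
    TopologicalSpace.isOpen_generateFrom_of_mem
      (mem_cylinders_iff.2 ⟨Set.univ, U, _, _, isOpen_univ, hU, rfl⟩),
    mem_cylinder_of_mem trivial hg h⟩

/-- Let g lie outside. If its range path does not begin with a, that is already an open condition.
Otherwise g lies in some `coterminalSet Λ c e` with d(a) ≤ d(c). A point common to this set and
`coterminalSet Λ a b` would nest the former in the latter and put g there too. -/
theorem isClosed_coterminalSet (a b : Λ.Mor) : IsClosed[topPGm Λ] (coterminalSet Λ a b) := by
  let _ := topPSm Λ
  let _ := topPGm Λ
  refine isOpen_compl_iff.1 (isOpen_iff_forall_mem_open.2 fun g hg => ?_)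
  by_cases ha : rangePath g ∈ startsWith Λ a
  · obtain ⟨a₁, b₁, h₁⟩ := exists_mem_coterminalSet g
    obtain ⟨c, e, h, -, hle⟩ := exists_mem_coterminalSet_of_le h₁ (mem_startsWith.1 ha)
    exact ⟨_, fun f hf hf' => hg (coterminalSet_subset hf' hf hle h),
      isOpen_coterminalSet c e, h⟩
  · exact ⟨rangePath ⁻¹' (startsWith Λ a)ᶜ, fun f hf hf' => hf (mem_startsWith.2 hf'.2.left),
      (isOpen_compl_startsWith Λ a).preimage continuous_rangePath, ha⟩

/-- The set `Z(F, n)` in the set of triples of an arbitrary partial action on paths. -/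
def segmentPairSet (T : PartialAction k (PartialPath Λ)) (F : Set (Λ.Mor × Λ.Mor))
    (n : Fin k → ℤ) : Set (actionTriples T) :=
  {g | ∃ (a b : Λ.Mor) (x : PartialPath Λ), (a, b) ∈ F ∧ degDiff (Λ.d a) (Λ.d b) = n ∧
    IsYeeConcat Λ a x g.1.1 ∧ g.1.2.1 = degDiff (Λ.d a) (Λ.d b) ∧ IsYeeConcat Λ b x g.1.2.2}

/-- The sets `Z(A *ₛ B, n) ∩ Z(F, n)ᶜ` for an arbitrary partial action on paths. -/
def segmentPairBasis (T : PartialAction k (PartialPath Λ)) : Set (Set (actionTriples T)) :=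
  {W | ∃ (n : Fin k → ℤ) (A B : Set Λ.Mor) (F : Set (Λ.Mor × Λ.Mor)),
    F.Finite ∧ F ⊆ sourcePairs Λ Set.univ Set.univ ∧
    W = segmentPairSet T (sourcePairs Λ A B) n ∩ (segmentPairSet T F n)ᶜ}

/-! ### Yeend's topology and finite alignment -/

theorem mem_segmentPairSet_iff {g : actionTriples (actM Λ)} {F : Set (Λ.Mor × Λ.Mor)}
    {n : Fin k → ℤ} : g ∈ segmentPairSet (actM Λ) F n ↔
      g.1.2.1 = n ∧ ∃ z ∈ F, g ∈ coterminalSet Λ z.1 z.2 := by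
  constructor
  · rintro ⟨a, b, x, hF, rfl, h1, h2, h3⟩
    rw [isYeeConcat_iff] at h1 h3
    exact ⟨h2, (a, b), hF, h2, h1.1, h3.1, h1.2.1, h3.2.1, h1.2.2.symm.trans h3.2.2⟩
  · rintro ⟨rfl, ⟨a, b⟩, hF, h1, h2⟩
    exact ⟨a, b, _, hF, h1.symm, isYeeConcat_iff.2 ⟨h2.left_mem, h2.left, rfl⟩, h1,
      isYeeConcat_iff.2 ⟨h2.right_mem, h2.right, h2.shift_eq⟩⟩

theorem coterminalSet_eq_segmentPairSet {g : actionTriples (actM Λ)} {a b : Λ.Mor}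
    (h : g ∈ coterminalSet Λ a b) :
    coterminalSet Λ a b =
      segmentPairSet (actM Λ) (sourcePairs Λ {a} {b}) (degDiff (Λ.d a) (Λ.d b)) := by
  ext f
  rw [mem_segmentPairSet_iff]
  constructor
  · intro hf
    exact ⟨hf.1, (a, b), ⟨rfl, rfl, h.2.source_eq⟩, hf⟩
  · rintro ⟨-, ⟨a', b'⟩, ⟨rfl, rfl, -⟩, hf⟩
    exact hf

theorem isTopologicalBasis_segmentPairBasis :
    @TopologicalSpace.IsTopologicalBasis _
      (TopologicalSpace.generateFrom (segmentPairBasis (actM Λ)))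
      (segmentPairBasis (actM Λ)) := by
  let _ := TopologicalSpace.generateFrom (segmentPairBasis (actM Λ))
  refine ⟨?_, ?_, rfl⟩
  · rintro _ ⟨n, A, B, F, hF, hF', rfl⟩ _ ⟨n', A', B', F', hF₁, hF₁', rfl⟩ g
      ⟨⟨hg, hgF⟩, ⟨hg', hgF'⟩⟩
    obtain ⟨rfl, z, hz, hgz⟩ := mem_segmentPairSet_iff.1 hg
    obtain ⟨rfl, z', hz', hgz'⟩ := mem_segmentPairSet_iff.1 hg'
    -- One pair (c, e) replaces both products A *ₛ B near g, and the finite exclusions are united.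
    obtain ⟨c, e, h, h'⟩ := exists_mem_coterminalSet_subset_inter hgz hgz'
    have hce := coterminalSet_eq_segmentPairSet h
    rw [← h.1] at hce
    refine ⟨_, ⟨_, {c}, {e}, F ∪ F', hF.union hF₁, Set.union_subset hF' hF₁', rfl⟩,
      ⟨hce.subset h, ?_⟩, ?_⟩
    · intro hc
      obtain ⟨h1, w, hw | hw, hgw⟩ := mem_segmentPairSet_iff.1 hc
      · exact hgF (mem_segmentPairSet_iff.2 ⟨h1, w, hw, hgw⟩)
      · exact hgF' (mem_segmentPairSet_iff.2 ⟨h1, w, hw, hgw⟩)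
    · rintro f ⟨hf, hfF⟩
      have hf1 := (mem_segmentPairSet_iff.1 hf).1
      have hf2 := h' (hce.symm.subset hf)
      refine ⟨⟨mem_segmentPairSet_iff.2 ⟨hf1, z, hz, hf2.1⟩, fun hc => hfF ?_⟩,
        ⟨mem_segmentPairSet_iff.2 ⟨hf1, z', hz', hf2.2⟩, fun hc => hfF ?_⟩⟩
      · obtain ⟨h1, w, hw, hgw⟩ := mem_segmentPairSet_iff.1 hc
        exact mem_segmentPairSet_iff.2 ⟨h1, w, Or.inl hw, hgw⟩
      · obtain ⟨h1, w, hw, hgw⟩ := mem_segmentPairSet_iff.1 hc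
        exact mem_segmentPairSet_iff.2 ⟨h1, w, Or.inr hw, hgw⟩
  · refine Set.eq_univ_of_forall fun g => ?_
    obtain ⟨a, b, h⟩ := exists_mem_coterminalSet g
    refine Set.mem_sUnion.2 ⟨_, ⟨_, {a}, {b}, ∅, Set.finite_empty, Set.empty_subset _, rfl⟩,
      (coterminalSet_eq_segmentPairSet h).subset h, fun hc => ?_⟩
    obtain ⟨-, w, hw, -⟩ := mem_segmentPairSet_iff.1 hc
    exact hw

theorem isOpen_of_mem_segmentPairBasis {W : Set (actionTriples (actM Λ))}
    (hW : W ∈ segmentPairBasis (actM Λ)) : IsOpen[topPGm Λ] W := by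
  let _ := topPGm Λ
  obtain ⟨n, A, B, F, hF, -, rfl⟩ := hW
  -- The degree component is constant on each coterminal set, hence locally constant.
  have hn : IsOpen {g : actionTriples (actM Λ) | g.1.2.1 = n} := by
    refine isOpen_iff_forall_mem_open.2 fun g hg => ?_
    obtain ⟨a, b, h⟩ := exists_mem_coterminalSet g
    exact ⟨_, fun f hf => hf.1.trans (h.1.symm.trans hg), isOpen_coterminalSet a b, h⟩
  -- A *ₛ B may be infinite but contributes a union of open sets. The excluded F is finite, so its
  -- union of closed sets is closed.
  have h₁ : segmentPairSet (actM Λ) (sourcePairs Λ A B) n ∩ (segmentPairSet (actM Λ) F n)ᶜ =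
      ({g | g.1.2.1 = n} ∩ ⋃ z ∈ sourcePairs Λ A B, coterminalSet Λ z.1 z.2) ∩
        (⋃ z ∈ F, coterminalSet Λ z.1 z.2)ᶜ := by
    ext g
    simp only [Set.mem_inter_iff, mem_segmentPairSet_iff, Set.mem_compl_iff, Set.mem_iUnion,
      Set.mem_ofPred_eq, exists_prop]
    exact and_congr_right fun h => not_congr (and_iff_right h.1)
  rw [h₁]
  exact (hn.inter (isOpen_biUnion fun z _ => isOpen_coterminalSet _ _)).inter
    (hF.isClosed_biUnion fun z _ => isClosed_coterminalSet _ _).isOpen_compl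

variable (Λ) in
/-- The topology of Yeend's path groupoid, on the triples of the shift action. -/
@[reducible] def topPGYee : TopologicalSpace (actionTriples (actM Λ)) :=
  TopologicalSpace.generateFrom (segmentPairBasis (actM Λ))

theorem isOpen_coterminalSet_diff {g : actionTriples (actM Λ)} {a b : Λ.Mor}
    (h : g ∈ coterminalSet Λ a b) {F : Set (Λ.Mor × Λ.Mor)} (hF : F.Finite)
    (hF' : F ⊆ sourcePairs Λ Set.univ Set.univ) :
    IsOpen[topPGYee Λ]
      (coterminalSet Λ a b ∩ (segmentPairSet (actM Λ) F (degDiff (Λ.d a) (Λ.d b)))ᶜ) := by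
  refine TopologicalSpace.isOpen_generateFrom_of_mem
    ⟨degDiff (Λ.d a) (Λ.d b), {a}, {b}, F, hF, hF', ?_⟩
  rw [coterminalSet_eq_segmentPairSet h]

theorem isOpen_coterminalSet_yee (a b : Λ.Mor) :
    IsOpen[topPGYee Λ] (coterminalSet Λ a b) := by
  let _ := topPGYee Λ
  refine isOpen_iff_forall_mem_open.2 fun g hg => ⟨_, Set.inter_subset_left,
    isOpen_coterminalSet_diff hg Set.finite_empty (Set.empty_subset _), hg, fun hc => ?_⟩
  obtain ⟨-, w, hw, -⟩ := mem_segmentPairSet_iff.1 hc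
  exact hw

/-- If `x = az` and `y = bz`, then `x` begins with `c` if and only if `(x, y)` is of the form
`(aew, bew)` for one of finitely many `e`, by finite alignment. -/
theorem exists_finite_pairs (hΛ : Λ.FinitelyAligned) {a b : Λ.Mor} (hab : Λ.s a = Λ.s b)
    (c : Λ.Mor) : ∃ F : Set (Λ.Mor × Λ.Mor), F.Finite ∧
      F ⊆ sourcePairs Λ Set.univ Set.univ ∧
      (∀ z ∈ F, degDiff (Λ.d z.1) (Λ.d z.2) = degDiff (Λ.d a) (Λ.d b)) ∧
      ∀ x y : PartialPath Λ, Coterminal a b x y →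
        (c ∈ x (0, Λ.d c) ↔ ∃ z ∈ F, Coterminal z.1 z.2 x y) := by
  obtain ⟨J, hJ, hJ'⟩ := hΛ a c
  have hsub : ∀ e ∈ J, e ∈ Λ.extensions a ∩ Λ.extensions c := fun e he => by
    rw [hJ']
    exact Set.mem_biUnion he (Λ.self_mem_extensions e)
  refine ⟨{z | z.1 ∈ J ∧ ∃ (e : Λ.Mor) (h : Λ.s a = Λ.r e),
    z = (Λ.comp a e h, Λ.comp b e (hab.symm.trans h))}, ?_, ?_, ?_, ?_⟩
  -- The first entry ae lies in J and determines e by cancellation, hence the whole pair.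
  · refine Set.Finite.of_finite_image (f := Prod.fst) (hJ.subset ?_) ?_
    · rintro _ ⟨z, hz, rfl⟩
      exact hz.1
    · rintro _ ⟨-, e, h, rfl⟩ _ ⟨-, e', h', rfl⟩ hee
      obtain ⟨-, rfl⟩ := Λ.comp_inj h h' hee rfl
      rfl
  · rintro _ ⟨-, e, h, rfl⟩
    exact ⟨trivial, trivial, by rw [Λ.s_comp, Λ.s_comp]⟩
  · rintro _ ⟨-, e, h, rfl⟩
    exact Coterminal.degDiff_comp
  · intro x y hxy
    constructor
    · intro hc
      -- The segment ap of x is long enough to extend c as well as a. It therefore extends some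
      -- member of J, with which x must then begin.
      obtain ⟨p, hp, hbp, hle, hp'⟩ := hxy.exists_common (dom_of_mem_zero hc)
      have hmem : Λ.comp a p hp ∈ Λ.extensions a ∩ Λ.extensions c :=
        ⟨⟨p, hp, rfl⟩, mem_extensions_of_mem hxy.left_mem hc hp'.left hle⟩
      rw [hJ'] at hmem
      obtain ⟨e, he, hpe⟩ := Set.mem_iUnion₂.1 hmem
      have hex := mem_of_mem_extensions hxy.left_mem hp'.left hpe
      obtain ⟨f, hf, rfl⟩ := (hsub e he).1
      exact ⟨_, ⟨he, f, hf, rfl⟩, hxy.comp_right hex⟩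
    · rintro ⟨_, ⟨he, f, hf, rfl⟩, hz⟩
      exact mem_of_mem_extensions hxy.left_mem hz.left (hsub _ he).2

/-- Within `coterminalSet Λ a b` the set S is cut out by Z(F, n) with n = d(a) - d(b). Removing it
leaves a basic open set, and each point of S there lies in a smaller open coterminal set. -/
theorem isClopen_of_finite_pairs {S : Set (actionTriples (actM Λ))}
    (hS : ∀ a b, Λ.s a = Λ.s b → ∃ F : Set (Λ.Mor × Λ.Mor), F.Finite ∧
      F ⊆ sourcePairs Λ Set.univ Set.univ ∧
      (∀ z ∈ F, degDiff (Λ.d z.1) (Λ.d z.2) = degDiff (Λ.d a) (Λ.d b)) ∧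
      ∀ g ∈ coterminalSet Λ a b, g ∈ S ↔ ∃ z ∈ F, Coterminal z.1 z.2 g.1.1 g.1.2.2) :
    @IsClopen _ (topPGYee Λ) S := by
  let _ := topPGYee Λ
  refine ⟨isOpen_compl_iff.1 ?_, ?_⟩ <;>
    refine isOpen_iff_forall_mem_open.2 fun g hg => ?_ <;>
    obtain ⟨a, b, h⟩ := exists_mem_coterminalSet g <;>
    obtain ⟨F, hF, hF', hd, hFS⟩ := hS a b h.2.source_eq
  · have key : ∀ f ∈ coterminalSet Λ a b,
        f ∈ S ↔ f ∈ segmentPairSet (actM Λ) F (degDiff (Λ.d a) (Λ.d b)) := by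
      intro f hf
      rw [hFS f hf, mem_segmentPairSet_iff, and_iff_right hf.1]
      exact exists_congr fun z => and_congr_right fun hz =>
        ⟨fun hc => ⟨hf.1.trans (hd z hz).symm, hc⟩, fun hc => hc.2⟩
    exact ⟨_, fun f hf hfS => hf.2 ((key f hf.1).1 hfS), isOpen_coterminalSet_diff h hF hF', h,
      fun hc => hg ((key g h).2 hc)⟩
  · obtain ⟨z, hz, hgz⟩ := (hFS g h).1 hg
    exact ⟨coterminalSet Λ a b ∩ coterminalSet Λ z.1 z.2,
      fun f hf => (hFS f hf.1).2 ⟨z, hz, hf.2.2⟩,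
      (isOpen_coterminalSet_yee a b).inter (isOpen_coterminalSet_yee z.1 z.2),
      h, h.1.trans (hd z hz).symm, hgz⟩

theorem isClopen_rangePath_preimage (hΛ : Λ.FinitelyAligned) (c : Λ.Mor) :
    @IsClopen _ (topPGYee Λ) (rangePath ⁻¹' startsWith Λ c) := by
  refine isClopen_of_finite_pairs fun a b hab => ?_
  obtain ⟨F, hF, hF', hd, h⟩ := exists_finite_pairs hΛ hab c
  exact ⟨F, hF, hF', hd, fun g hg => mem_startsWith.trans (h _ _ hg.2)⟩

theorem isClopen_sourcePath_preimage (hΛ : Λ.FinitelyAligned) (c : Λ.Mor) :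
    @IsClopen _ (topPGYee Λ) (sourcePath ⁻¹' startsWith Λ c) := by
  refine isClopen_of_finite_pairs fun a b hab => ?_
  obtain ⟨F, hF, hF', hd, h⟩ := exists_finite_pairs hΛ hab.symm c
  -- Inversion exchanges range and source, so the pairs found for (b, a) are swapped back.
  refine ⟨Prod.swap '' F, hF.image _, ?_, ?_, fun g hg => ?_⟩
  · rintro _ ⟨z, hz, rfl⟩
    exact ⟨trivial, trivial, (hF' hz).2.2.symm⟩
  · rintro _ ⟨z, hz, rfl⟩
    rw [Prod.fst_swap, Prod.snd_swap, ← neg_degDiff, hd z hz, neg_degDiff]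
  · refine mem_startsWith.trans ((h _ _ hg.2.symm).trans ?_)
    rw [Set.exists_mem_image]
    exact exists_congr fun z => and_congr_right fun _ => ⟨fun h => h.symm, fun h => h.symm⟩

/-- A cylinder is, near each of its points, the intersection of a coterminal set with preimages of
open sets under the range and source maps, which are continuous for Yeend's topology. -/
theorem topPGm_eq_topPGYee (hΛ : Λ.FinitelyAligned) : topPGm Λ = topPGYee Λ := by
  refine le_antisymm (le_generateFrom fun W hW => isOpen_of_mem_segmentPairBasis hW)
    (le_generateFrom ?_)
  intro W hW
  obtain ⟨U, V, m, n, hU, hV, rfl⟩ := mem_cylinders_iff.1 hW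
  let _ := topPSm Λ
  let _ := topPGYee Λ
  have hr : Continuous (rangePath (Λ := Λ)) :=
    continuous_of_startsWith Λ (isClopen_rangePath_preimage hΛ)
  have hs : Continuous (sourcePath (Λ := Λ)) :=
    continuous_of_startsWith Λ (isClopen_sourcePath_preimage hΛ)
  refine isOpen_iff_forall_mem_open.2 fun g hg => ?_
  obtain ⟨h1, h2, a, b, ha, hb, h⟩ := mem_cylinder_iff.1 hg
  exact ⟨rangePath ⁻¹' U ∩ sourcePath ⁻¹' V ∩ coterminalSet Λ a b,
    fun f hf => mem_cylinder_iff.2 ⟨hf.1.1, hf.1.2, a, b, ha, hb, hf.2⟩,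
    ((hU.preimage hr).inter (hV.preimage hs)).inter (isOpen_coterminalSet_yee a b),
    ⟨h1, h2⟩, h⟩

/-- Since `segmentPairBasis` is defined for an arbitrary partial action, rewriting along
`actM_eq_actYee` transports the set of triples and its topology together. -/
theorem PGYee_eq : PGYee Λ = tripleGroupoid (actionTriples (actM Λ)) (topPGYee Λ) := by
  change tripleGroupoid (actionTriples (actYee Λ))
    (TopologicalSpace.generateFrom (segmentPairBasis (actYee Λ))) = _
  rw [← actM_eq_actYee]

theorem isTopologicalBasis_yeeBasis :
    @TopologicalSpace.IsTopologicalBasis _ (PGYee Λ).topology (yeeBasis Λ) := by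
  change @TopologicalSpace.IsTopologicalBasis (actionTriples (actYee Λ))
    (TopologicalSpace.generateFrom (segmentPairBasis (actYee Λ))) (segmentPairBasis (actYee Λ))
  rw [← actM_eq_actYee]
  exact isTopologicalBasis_segmentPairBasis

theorem PGm_eq_PGYee (hΛ : Λ.FinitelyAligned) : PGm Λ = PGYee Λ := by
  rw [PGYee_eq, ← topPGm_eq_topPGYee hΛ]
  rfl

end Topologies

/-! ### Groupoids of triples -/

section Triples

variable {k : ℕ} {α : Type u} {C : Set (α × (Fin k → ℤ) × α)} {τ : TopologicalSpace C}

theorem mem_comp_tripleGroupoid {g h c : α × (Fin k → ℤ) × α} :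
    c ∈ (tripleGroupoid C τ).comp (g, h) ↔
      g ∈ C ∧ h ∈ C ∧ g.2.2 = h.1 ∧ c = (g.1, g.2.1 + h.2.1, h.2.2) := by
  constructor
  · rintro ⟨⟨h1, h2, h3⟩, rfl⟩
    exact ⟨h1, h2, h3, rfl⟩
  · rintro ⟨h1, h2, h3, rfl⟩
    exact ⟨⟨h1, h2, h3⟩, rfl⟩

theorem mem_inv_tripleGroupoid {g c : α × (Fin k → ℤ) × α} :
    c ∈ (tripleGroupoid C τ).inv g ↔ g ∈ C ∧ c = (g.2.2, -g.2.1, g.1) := by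
  constructor
  · rintro ⟨h1, rfl⟩
    exact ⟨h1, rfl⟩
  · rintro ⟨h1, rfl⟩
    exact ⟨h1, rfl⟩

theorem tripleGroupoid_isGroupoid
    (hcomp : ∀ x y z q r, (x, q, y) ∈ C → (y, r, z) ∈ C → (x, q + r, z) ∈ C)
    (hinv : ∀ x y q, (x, q, y) ∈ C → (y, -q, x) ∈ C) : (tripleGroupoid C τ).IsGroupoid where
  comp_mem := by
    rintro ⟨x, q, y⟩ ⟨y', r, z⟩ c hc
    obtain ⟨h1, h2, h3, rfl⟩ := mem_comp_tripleGroupoid.1 hc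
    obtain rfl : y = y' := h3
    exact ⟨h1, h2, hcomp _ _ _ _ _ h1 h2⟩
  inv_dom g := Iff.rfl
  inv_mem := by
    rintro ⟨x, q, y⟩ g' hg'
    obtain ⟨h, rfl⟩ := mem_inv_tripleGroupoid.1 hg'
    exact hinv _ _ _ h
  assoc := by
    rintro ⟨x, q, y⟩ ⟨y', r, z⟩ ⟨z', t, w⟩ a ha b hb
    obtain ⟨h1, h2, h3, rfl⟩ := mem_comp_tripleGroupoid.1 ha
    obtain ⟨-, h4, h5, rfl⟩ := mem_comp_tripleGroupoid.1 hb
    obtain rfl : y = y' := h3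
    obtain rfl : z = z' := h5
    exact ⟨(x, q + (r + t), w),
      mem_comp_tripleGroupoid.2 ⟨h1, hcomp _ _ _ _ _ h2 h4, rfl, rfl⟩,
      mem_comp_tripleGroupoid.2 ⟨hcomp _ _ _ _ _ h1 h2, h4, rfl, by rw [add_assoc]⟩⟩
  inv_inv := by
    rintro ⟨x, q, y⟩ g' hg'
    obtain ⟨h, rfl⟩ := mem_inv_tripleGroupoid.1 hg'
    exact mem_inv_tripleGroupoid.2 ⟨hinv _ _ _ h, by rw [neg_neg]⟩
  inv_comp_dom := by
    rintro ⟨x, q, y⟩ g' hg'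
    obtain ⟨h, rfl⟩ := mem_inv_tripleGroupoid.1 hg'
    exact ⟨hinv _ _ _ h, h, rfl⟩
  inv_comp_cancel := by
    rintro ⟨x, q, y⟩ ⟨y', r, z⟩ g' hg' c hc
    obtain ⟨h, rfl⟩ := mem_inv_tripleGroupoid.1 hg'
    obtain ⟨h1, h2, h3, rfl⟩ := mem_comp_tripleGroupoid.1 hc
    obtain rfl : y = y' := h3
    exact mem_comp_tripleGroupoid.2
      ⟨hinv _ _ _ h, hcomp _ _ _ _ _ h1 h2, rfl, by rw [neg_add_cancel_left]⟩
  comp_inv_cancel := by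
    rintro ⟨x, q, y⟩ ⟨y', r, z⟩ g' hg' c hc
    obtain ⟨h, rfl⟩ := mem_inv_tripleGroupoid.1 hg'
    obtain ⟨h1, h2, h3, rfl⟩ := mem_comp_tripleGroupoid.1 hc
    obtain rfl : y = y' := h3
    exact mem_comp_tripleGroupoid.2
      ⟨hcomp _ _ _ _ _ h1 h2, hinv _ _ _ h, rfl, by rw [add_neg_cancel_right]⟩

end Triples

/-! ### Reductions -/

namespace GroupoidData

variable {α : Type u} {G : GroupoidData α} {U : Set α}

theorem mem_comp_reduction {g h c : α} : c ∈ (G.reduction U).comp (g, h) ↔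
    g ∈ G.reductionCarrier U ∧ h ∈ G.reductionCarrier U ∧ c ∈ G.comp (g, h) := by
  constructor
  · rintro ⟨⟨h1, h2, h3⟩, rfl⟩
    exact ⟨h1, h2, Part.get_mem h3⟩
  · rintro ⟨h1, h2, h3, rfl⟩
    exact ⟨⟨h1, h2, h3⟩, rfl⟩

theorem mem_inv_reduction {g c : α} :
    c ∈ (G.reduction U).inv g ↔ g ∈ G.reductionCarrier U ∧ c ∈ G.inv g := by
  constructor
  · rintro ⟨⟨h1, h2⟩, rfl⟩
    exact ⟨h1, Part.get_mem h2⟩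
  · rintro ⟨h1, h2, rfl⟩
    exact ⟨⟨h1, h2⟩, rfl⟩

/-- The reduction of a topological groupoid to any set of units is a topological groupoid. -/
theorem IsTopologicalGroupoid.reduction (hG : G.IsTopologicalGroupoid)
    (hcomp : ∀ g h, g ∈ G.reductionCarrier U → h ∈ G.reductionCarrier U →
      ∀ c ∈ G.comp (g, h), c ∈ G.reductionCarrier U)
    (hinv : ∀ g ∈ G.reductionCarrier U, ∀ c ∈ G.inv g, c ∈ G.reductionCarrier U) :
    (G.reduction U).IsTopologicalGroupoid where
  isGroupoid :=
    { comp_mem := by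
        intro g h c hc
        obtain ⟨h1, h2, h3⟩ := mem_comp_reduction.1 hc
        exact ⟨h1, h2, hcomp g h h1 h2 c h3⟩
      inv_dom := fun g => ⟨fun h => h.1, fun h => ⟨h, (hG.isGroupoid.inv_dom g).2 h.1⟩⟩
      inv_mem := by
        intro g g' hg'
        obtain ⟨h1, h2⟩ := mem_inv_reduction.1 hg'
        exact hinv g h1 g' h2
      assoc := by
        intro f g h a ha b hb
        obtain ⟨h1, h2, h3⟩ := mem_comp_reduction.1 ha
        obtain ⟨-, h4, h5⟩ := mem_comp_reduction.1 hb
        obtain ⟨c, hc, hc'⟩ := hG.isGroupoid.assoc f g h a h3 b h5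
        exact ⟨c, mem_comp_reduction.2 ⟨h1, hcomp _ _ h2 h4 _ h5, hc⟩,
          mem_comp_reduction.2 ⟨hcomp _ _ h1 h2 _ h3, h4, hc'⟩⟩
      inv_inv := by
        intro g g' hg'
        obtain ⟨h1, h2⟩ := mem_inv_reduction.1 hg'
        exact mem_inv_reduction.2 ⟨hinv g h1 g' h2, hG.isGroupoid.inv_inv g g' h2⟩
      inv_comp_dom := by
        intro g g' hg'
        obtain ⟨h1, h2⟩ := mem_inv_reduction.1 hg'
        exact ⟨hinv g h1 g' h2, h1, hG.isGroupoid.inv_comp_dom g g' h2⟩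
      inv_comp_cancel := by
        intro g h g' hg' c hc
        obtain ⟨h1, h2⟩ := mem_inv_reduction.1 hg'
        obtain ⟨-, h3, h4⟩ := mem_comp_reduction.1 hc
        exact mem_comp_reduction.2 ⟨hinv g h1 g' h2, hcomp _ _ h1 h3 _ h4,
          hG.isGroupoid.inv_comp_cancel g h g' h2 c h4⟩
      comp_inv_cancel := by
        intro g h h' hh' c hc
        obtain ⟨h1, h2⟩ := mem_inv_reduction.1 hh'
        obtain ⟨h3, -, h4⟩ := mem_comp_reduction.1 hc
        exact mem_comp_reduction.2 ⟨hcomp _ _ h3 h1 _ h4, hinv h h1 h' h2,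
          hG.isGroupoid.comp_inv_cancel g h h' h2 c h4⟩ }
  continuous_comp := by
    let _ := G.topology
    let _ := (G.reduction U).topology
    let ι : (G.reduction U).carrier → G.carrier := fun g => ⟨g.1, g.2.1⟩
    have hι : Continuous ι := continuous_induced_dom
    intro W hW
    obtain ⟨W', hW', rfl⟩ := isOpen_induced_iff.1 hW
    -- Composition in the reduction is the restriction of the composition of G along this continuous
    -- inclusion of composable pairs.
    let φ : (G.reduction U).composablePairs → G.composablePairs :=
      fun z => ⟨(ι z.1.1, ι z.1.2), z.2.2.2⟩
    have hφ : Continuous φ := Continuous.subtype_mk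
      ((hι.comp (continuous_fst.comp continuous_subtype_val)).prodMk
        (hι.comp (continuous_snd.comp continuous_subtype_val))) _
    refine (congrArg IsOpen (Set.ext fun z => ?_)).mpr ((hG.continuous_comp W' hW').preimage hφ)
    constructor
    · rintro ⟨c, hc, hc'⟩
      exact ⟨ι c, hc, (mem_comp_reduction.1 hc').2.2⟩
    · rintro ⟨c, hc, hc'⟩
      exact ⟨⟨c.1, hcomp _ _ z.1.1.2 z.1.2.2 _ hc'⟩, hc,
        mem_comp_reduction.2 ⟨z.1.1.2, z.1.2.2, hc'⟩⟩
  continuous_inv := by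
    let _ := G.topology
    let _ := (G.reduction U).topology
    let ι : (G.reduction U).carrier → G.carrier := fun g => ⟨g.1, g.2.1⟩
    have hι : Continuous ι := continuous_induced_dom
    intro W hW
    obtain ⟨W', hW', rfl⟩ := isOpen_induced_iff.1 hW
    refine (congrArg IsOpen (Set.ext fun g => ?_)).mpr ((hG.continuous_inv W' hW').preimage hι)
    constructor
    · rintro ⟨c, hc, hc'⟩
      exact ⟨ι c, hc, (mem_inv_reduction.1 hc').2⟩
    · rintro ⟨c, hc, hc'⟩
      exact ⟨⟨c.1, hinv _ g.2 _ hc'⟩, hc, mem_inv_reduction.2 ⟨g.2, hc'⟩⟩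

end GroupoidData

/-! ### Continuity of the operations of the path groupoids -/

section PathGroupoids

variable {k : ℕ} {Λ : KGraph.{u} k}

theorem mem_reductionCarrier_iff {α : Type u} {C : Set (α × (Fin k → ℤ) × α)}
    {τ : TopologicalSpace C} (hinv : ∀ x y q, (x, q, y) ∈ C → (y, -q, x) ∈ C) {X : Set α}
    {x y : α} {q : Fin k → ℤ} :
    (x, q, y) ∈ (tripleGroupoid C τ).reductionCarrier (unitTriples X) ↔
      (x, q, y) ∈ C ∧ x ∈ X ∧ y ∈ X := by
  constructor
  · rintro ⟨h, g', hg', ⟨v, hv, a, ha, rfl⟩, ⟨w, hw, b, hb, rfl⟩⟩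
    obtain ⟨-, rfl⟩ := mem_inv_tripleGroupoid.1 hg'
    obtain ⟨-, -, -, hv⟩ := mem_comp_tripleGroupoid.1 hv
    obtain ⟨-, -, -, hw⟩ := mem_comp_tripleGroupoid.1 hw
    obtain rfl : a = y := congrArg Prod.fst hv
    obtain rfl : b = x := congrArg Prod.fst hw
    exact ⟨h, hb, ha⟩
  · rintro ⟨h, hx, hy⟩
    refine ⟨h, _, mem_inv_tripleGroupoid.2 ⟨h, rfl⟩,
      ⟨_, mem_comp_tripleGroupoid.2 ⟨hinv _ _ _ h, h, rfl, rfl⟩, y, hy, ?_⟩,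
      ⟨_, mem_comp_tripleGroupoid.2 ⟨h, hinv _ _ _ h, rfl, rfl⟩, x, hx, ?_⟩⟩
    · rw [neg_add_cancel]
    · rw [add_neg_cancel]

/-- Once the two pairs share their middle segment, coterminality is transitive and the degree
differences telescope. -/
theorem actionTriples_comp {x y z : PartialPath Λ} {q r : Fin k → ℤ}
    (h : (x, q, y) ∈ actionTriples (actM Λ)) (h' : (y, r, z) ∈ actionTriples (actM Λ)) :
    (x, q + r, z) ∈ actionTriples (actM Λ) := by
  obtain ⟨a, b, rfl, hab⟩ := mem_actionTriples_iff.1 h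
  obtain ⟨b', c, rfl, hbc⟩ := mem_actionTriples_iff.1 h'
  obtain ⟨a₁, b₁, c₁, h1, h2, h3, h4⟩ := hab.exists_middle hbc
  exact mem_actionTriples_iff.2
    ⟨a₁, c₁, by rw [← h3, ← h4, degDiff_add_degDiff], h1.trans h2⟩

theorem actionTriples_inv {x y : PartialPath Λ} {q : Fin k → ℤ}
    (h : (x, q, y) ∈ actionTriples (actM Λ)) : (y, -q, x) ∈ actionTriples (actM Λ) := by
  obtain ⟨a, b, rfl, hab⟩ := mem_actionTriples_iff.1 h
  exact mem_actionTriples_iff.2 ⟨b, a, neg_degDiff _ _, hab.symm⟩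

theorem PGm_eq : PGm Λ = tripleGroupoid (actionTriples (actM Λ)) (topPGm Λ) := rfl

/-- Near a composable pair, composites stay in a given neighbourhood of the composite. -/
theorem exists_nhds_comp {g h c : actionTriples (actM Λ)} (hgh : g.1.2.2 = h.1.1)
    (hc : c.1 = (g.1.1, g.1.2.1 + h.1.2.1, h.1.2.2)) {W : Set (actionTriples (actM Λ))}
    (hW : IsOpen[topPGm Λ] W) (hcW : c ∈ W) :
    ∃ V₁ V₂ : Set (actionTriples (actM Λ)), IsOpen[topPGm Λ] V₁ ∧ IsOpen[topPGm Λ] V₂ ∧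
      g ∈ V₁ ∧ h ∈ V₂ ∧ ∀ g' ∈ V₁, ∀ h' ∈ V₂, ∀ c' : actionTriples (actM Λ),
        g'.1.2.2 = h'.1.1 → c'.1 = (g'.1.1, g'.1.2.1 + h'.1.2.1, h'.1.2.2) → c' ∈ W := by
  let _ := topPSm Λ
  let _ := topPGm Λ
  obtain ⟨T, hT, hcT, hTW⟩ := isTopologicalBasis_cylinders.exists_subset_of_mem_open hcW hW
  obtain ⟨U, V, m, n, hU, hV, rfl⟩ := mem_cylinders_iff.1 hT
  obtain ⟨h1, h2, a, b, ha, hb, hcab⟩ := mem_cylinder_iff.1 hcT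
  obtain ⟨p, q₁, hg⟩ := exists_mem_coterminalSet g
  obtain ⟨q₂, t, hh⟩ := exists_mem_coterminalSet h
  have hh2 := hh.2
  rw [← hgh] at hh2
  obtain ⟨p₁, q, t₁, h3, h4, h5, h6⟩ := hg.2.exists_middle hh2
  have hcx : c.1.1 = g.1.1 := congrArg (fun z => z.1) hc
  have hcy : c.1.2.2 = h.1.2.2 := congrArg (fun z => z.2.2) hc
  have hcq : c.1.2.1 = g.1.2.1 + h.1.2.1 := congrArg (fun z => z.2.1) hc
  have ha' : a ∈ g.1.1 (0, Λ.d a) := hcx ▸ hcab.2.left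
  -- All three segments are lengthened by e so that the first has degree at least d(a). The
  -- coterminal set around c is then contained in that of (a, b).
  obtain ⟨e, hpe, hqe, hle, h7⟩ := h3.exists_common (dom_of_mem_zero ha')
  have h8 := h4.comp_right h7.right
  have hg' : g ∈ coterminalSet Λ (Λ.comp p₁ e hpe) (Λ.comp q e hqe) :=
    ⟨by rw [Coterminal.degDiff_comp, h5, hg.1], h7⟩
  have hh' : h ∈ coterminalSet Λ (Λ.comp q e hqe)
      (Λ.comp t₁ e (h4.source_eq.symm.trans hqe)) :=
    ⟨by rw [Coterminal.degDiff_comp, h6, hh.1], hgh ▸ h8⟩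
  have hc' : c ∈ coterminalSet Λ (Λ.comp p₁ e hpe)
      (Λ.comp t₁ e (h4.source_eq.symm.trans hqe)) := by
    refine ⟨?_, ?_⟩
    · rw [hcq, hg'.1, hh'.1, degDiff_add_degDiff]
    · rw [hcx, hcy]
      exact h7.trans h8
  refine ⟨rangePath ⁻¹' U ∩ coterminalSet Λ _ _, sourcePath ⁻¹' V ∩ coterminalSet Λ _ _,
    (hU.preimage continuous_rangePath).inter (isOpen_coterminalSet _ _),
    (hV.preimage continuous_sourcePath).inter (isOpen_coterminalSet _ _),
    ⟨?_, hg'⟩, ⟨?_, hh'⟩, ?_⟩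
  · have : rangePath c = rangePath g := Subtype.ext hcx
    exact Set.mem_preimage.2 (this ▸ h1)
  · have : sourcePath c = sourcePath h := Subtype.ext hcy
    exact Set.mem_preimage.2 (this ▸ h2)
  -- Nearby composable pairs have the same middle segment, so their composite is coterminal along
  -- the outer ones.
  · rintro f ⟨hfU, hf⟩ l ⟨hlV, hl⟩ c₁ hfl hc₁
    have e1 : c₁.1.1 = f.1.1 := congrArg (fun z => z.1) hc₁
    have e2 : c₁.1.2.2 = l.1.2.2 := congrArg (fun z => z.2.2) hc₁
    have e3 : c₁.1.2.1 = f.1.2.1 + l.1.2.1 := congrArg (fun z => z.2.1) hc₁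
    refine hTW (mem_cylinder_iff.2 ⟨?_, ?_, a, b, ha, hb,
      coterminalSet_subset hcab hc' hle ⟨?_, ?_⟩⟩)
    · have : rangePath c₁ = rangePath f := Subtype.ext e1
      exact this ▸ hfU
    · have : sourcePath c₁ = sourcePath l := Subtype.ext e2
      exact this ▸ hlV
    · rw [e3, hf.1, hl.1, degDiff_add_degDiff]
    · rw [e1, e2]
      have := hl.2
      rw [← hfl] at this
      exact hf.2.trans this

theorem PGm_isTopologicalGroupoid : (PGm Λ).IsTopologicalGroupoid where
  isGroupoid := tripleGroupoid_isGroupoid (fun _ _ _ _ _ => actionTriples_comp)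
    (fun _ _ _ => actionTriples_inv)
  continuous_comp := by
    let _ := topPGm Λ
    let _ : TopologicalSpace (PGm Λ).carrier := topPGm Λ
    intro W hW
    refine isOpen_iff_forall_mem_open.2 ?_
    rintro ⟨⟨g, h⟩, hz⟩ ⟨c, hcW, hc⟩
    obtain ⟨-, -, hgh, hc⟩ := mem_comp_tripleGroupoid.1 hc
    obtain ⟨V₁, V₂, hV₁, hV₂, hg, hh, key⟩ := exists_nhds_comp hgh hc hW hcW
    have hval : Continuous (Subtype.val :
        (PGm Λ).composablePairs → (PGm Λ).carrier × (PGm Λ).carrier) := continuous_subtype_val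
    refine ⟨Subtype.val ⁻¹' (V₁ ×ˢ V₂), ?_, (IsOpen.prod hV₁ hV₂).preimage hval, ⟨hg, hh⟩⟩
    rintro ⟨⟨⟨⟨x, q, y⟩, hg'⟩, ⟨⟨y', r, z⟩, hh'⟩⟩, hz'⟩ ⟨hgV, hhV⟩
    obtain rfl : y = y' := hz'.2.2
    exact ⟨⟨(x, q + r, z), actionTriples_comp hg' hh'⟩, key _ hgV _ hhV _ rfl rfl,
      mem_comp_tripleGroupoid.2 ⟨hg', hh', rfl, rfl⟩⟩
  continuous_inv := by
    let _ := topPSm Λ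
    let _ := topPGm Λ
    let _ : TopologicalSpace (PGm Λ).carrier := topPGm Λ
    intro W hW
    refine isOpen_iff_forall_mem_open.2 ?_
    rintro ⟨⟨x, q, y⟩, hg⟩ ⟨c, hcW, hc⟩
    obtain ⟨-, hc⟩ := mem_inv_tripleGroupoid.1 hc
    obtain rfl : c = ⟨(y, -q, x), actionTriples_inv hg⟩ := Subtype.ext hc
    obtain ⟨T, hT, hcT, hTW⟩ := isTopologicalBasis_cylinders.exists_subset_of_mem_open hcW hW
    obtain ⟨U, V, m, n, hU, hV, rfl⟩ := mem_cylinders_iff.1 hT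
    -- Inversion turns the cylinder of (U, m, n, V) into that of (V, n, m, U).
    have key : ∀ (x y : PartialPath Λ) (q : Fin k → ℤ) (hg : (x, q, y) ∈ _)
        (hg' : (y, -q, x) ∈ _) (U V : Set (PSm Λ)) (m n : Fin k → ℕ),
        (⟨(y, -q, x), hg'⟩ : actionTriples (actM Λ)) ∈ cylinder (actM Λ) U m n V →
        (⟨(x, q, y), hg⟩ : actionTriples (actM Λ)) ∈ cylinder (actM Λ) V n m U := by
      rintro x y q hg hg' U V m n ⟨h1, h2, h3, z, h4, h5⟩
      exact ⟨by rw [← neg_degDiff, ← h1, neg_neg], h3, h2, z, h5, h4⟩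
    refine ⟨cylinder (actM Λ) V n m U, ?_, TopologicalSpace.isOpen_generateFrom_of_mem
      (mem_cylinders_iff.2 ⟨V, U, n, m, hV, hU, rfl⟩), key _ _ _ _ _ _ _ _ _ hcT⟩
    rintro ⟨⟨x', q', y'⟩, hf⟩ hfc
    refine ⟨⟨(y', -q', x'), actionTriples_inv hf⟩, hTW ?_,
      mem_inv_tripleGroupoid.2 ⟨hf, rfl⟩⟩
    obtain ⟨h1, h2, h3, z, h4, h5⟩ := hfc
    exact ⟨by rw [← neg_degDiff]; exact congrArg (fun z => -z) h1, h3, h2, z, h5, h4⟩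

theorem BPGm_isTopologicalGroupoid : (BPGm Λ).IsTopologicalGroupoid := by
  have hinv : ∀ x y q, (x, q, y) ∈ actionTriples (actM Λ) → (y, -q, x) ∈ actionTriples (actM Λ) :=
    fun _ _ _ => actionTriples_inv
  refine PGm_isTopologicalGroupoid.reduction ?_ ?_
  · rintro ⟨x, q, y⟩ ⟨y', r, z⟩ hg hh c hc
    rw [PGm_eq] at hg hh hc ⊢
    obtain ⟨-, -, h, rfl⟩ := mem_comp_tripleGroupoid.1 hc
    obtain rfl : y = y' := h
    rw [mem_reductionCarrier_iff hinv] at hg hh ⊢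
    exact ⟨actionTriples_comp hg.1 hh.1, hg.2.1, hh.2.2⟩
  · rintro ⟨x, q, y⟩ hg c hc
    rw [PGm_eq] at hg hc ⊢
    obtain ⟨-, rfl⟩ := mem_inv_tripleGroupoid.1 hc
    rw [mem_reductionCarrier_iff hinv] at hg ⊢
    exact ⟨actionTriples_inv hg.1, hg.2.2, hg.2.1⟩

/-! ### Boundary paths -/

/-- Two morphisms have a common extension if and only if they have one of minimal degree. -/
theorem minCommonExtensions_nonempty_iff {a b : Λ.Mor} :
    (minCommonExtensions Λ a b).Nonempty ↔ (Λ.extensions a ∩ Λ.extensions b).Nonempty := by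
  constructor
  · rintro ⟨z, h₁, h₂, h, -⟩
    exact ⟨_, ⟨_, h₁, rfl⟩, ⟨_, h₂, h.symm⟩⟩
  · rintro ⟨c, ha, hb⟩
    -- The common extension is cut at degree d(a) ∨ d(b). The initial part still extends both a and
    -- b, because its degree dominates theirs.
    obtain ⟨c', e, h, rfl, hd⟩ := Λ.exists_factor c
      (sup_le (Λ.d_le_of_mem_extensions ha) (Λ.d_le_of_mem_extensions hb))
    have hc' : Λ.comp c' e h ∈ Λ.extensions c' := ⟨e, h, rfl⟩
    obtain ⟨f, hf, hf'⟩ := Λ.mem_extensions_of_le ha hc' (hd ▸ le_sup_left)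
    obtain ⟨l, hl, hl'⟩ := Λ.mem_extensions_of_le hb hc' (hd ▸ le_sup_right)
    exact ⟨(f, l), hf, hl, hf'.trans hl'.symm, hf' ▸ hd⟩

theorem mem_yeeCE_iff {v : Λ.Mor} {E : Set Λ.Mor} :
    E ∈ yeeCE Λ v ↔ E.Finite ∧ v ∈ Λ.r '' E ∧ Exhaustive Λ E := by
  simp only [Exhaustive, ← minCommonExtensions_nonempty_iff]
  rfl

variable (Λ) in
-- The vertex x(m, m) is the source of x(0, m), so both conditions test the same vertices against
-- the same finite exhaustive sets.
theorem BPSm_eq_BPSYee : BPSm Λ = BPSYee Λ := by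
  ext x
  constructor
  · rintro ⟨hx, h⟩
    obtain ⟨d, hd⟩ := mem_PSm_iff.1 hx
    refine ⟨d, hasDegree_iff_isPath.2 hd, fun m hm v hv E hE => ?_⟩
    obtain ⟨hfin, hvE, hex⟩ := mem_yeeCE_iff.1 hE
    obtain ⟨a, ha⟩ := Part.dom_iff_mem.1 ((hd.zero_dom_iff m).2 hm)
    obtain rfl := Part.mem_unique hv (hd.s_mem ha)
    exact h m E a ha hfin hex hvE
  · rintro ⟨d, hd, h⟩
    have hd := hasDegree_iff_isPath.1 hd
    exact ⟨mem_PSm_iff.2 ⟨d, hd⟩, fun m E a ha hE hex hvE =>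
      h m (hd.leDeg_of_mem ha) _ (hd.s_mem ha) E (mem_yeeCE_iff.2 ⟨hE, hvE, hex⟩)⟩

end PathGroupoids

/-! ### Assembly of the statements -/

theorem mainTheorem5 {k : ℕ} (Λ : KGraph.{u} k) (hΛ : Λ.FinitelyAligned) :
    -- the path prototypes coincide, with the explicit correspondence
    ({Ω : KGraph.{0} k | ∃ m : ℕ → Fin k → ℕ, Monotone m ∧ Ω = omegaSeq m} =
        {Ω : KGraph.{0} k | ∃ m : Fin k → ℕ∞, Ω = yeeOmega m}) ∧
    (∀ m : Fin k → ℕ∞,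
      Monotone (fun (n : ℕ) (i : Fin k) => if m i = ⊤ then n else (m i).toNat) ∧
      yeeOmega m =
        omegaSeq (fun (n : ℕ) (i : Fin k) => if m i = ⊤ then n else (m i).toNat)) ∧
    (∀ m : ℕ → Fin k → ℕ, Monotone m →
      omegaSeq m = yeeOmega (fun i => ⨆ n, (m n i : ℕ∞))) ∧
    -- the path spaces and the shift actions coincide
    PSm Λ = PSYee Λ ∧
    IsSemigroupAction (actM Λ) ∧
    (∀ (x : PartialPath Λ) (m : Fin k → ℕ∞) (p : Fin k → ℕ), HasDegree Λ x m → LeDeg p m →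
      ∃! y, IsYeeShift Λ p x y) ∧
    actM Λ = actYee Λ ∧
    -- the two collections are bases of the topologies that they generate
    @TopologicalSpace.IsTopologicalBasis _ (PGm Λ).topology (cylinders (actM Λ) (topPSm Λ)) ∧
    @TopologicalSpace.IsTopologicalBasis _ (PGYee Λ).topology (yeeBasis Λ) ∧
    -- the path groupoids coincide as topological groupoids
    (PGm Λ).IsTopologicalGroupoid ∧
    PGm Λ = PGYee Λ ∧
    -- the boundary-path spaces and groupoids coincide
    BPSm Λ = BPSYee Λ ∧
    (BPGm Λ).IsTopologicalGroupoid ∧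
    BPGm Λ = BPGYee Λ := by
  refine ⟨?_, fun m => ⟨truncation_monotone m, yeeOmega_eq_omegaSeq m⟩,
    fun m hm => omegaSeq_eq_yeeOmega hm, PSm_eq_PSYee Λ, actM_isSemigroupAction,
    existsUnique_isYeeShift, actM_eq_actYee, isTopologicalBasis_cylinders,
    isTopologicalBasis_yeeBasis, PGm_isTopologicalGroupoid, PGm_eq_PGYee hΛ,
    BPSm_eq_BPSYee Λ, BPGm_isTopologicalGroupoid, ?_⟩
  · ext Ω
    constructor
    · rintro ⟨m, hm, rfl⟩
      exact ⟨_, omegaSeq_eq_yeeOmega hm⟩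
    · rintro ⟨m, rfl⟩
      exact ⟨_, truncation_monotone m, yeeOmega_eq_omegaSeq m⟩
  -- A reduction depends only on the groupoid and the set of units, and both have been identified.
  · rw [BPGm, BPGYee, PGm_eq_PGYee hΛ, BPSm_eq_BPSYee]
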